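/- All functions and vector fields are real and smooth ($C^\infty$); an *interval* is a nonempty open interval of the $t$-line, and a subscript $t$ denotes the derivative. For an interval $I$, let $\mathfrak g(I)$ be the Lie algebra of the vector fields on $I\times\mathbb R^3\ni(t,x,y,u)$ that is spanned by \[ \begin{aligned} &D^t(\tau)=\tau\partial_t+\tfrac13\tau_tx\,\partial_x+\tfrac13\tau_ty\,\partial_y-\tfrac1{18}\tau_{tt}(x^3+y^3)\partial_u,\qquad D^{\rm s}=x\partial_x+y\partial_y+3u\partial_u,\\ &P^x(\chi)=\chi\partial_x-\tfrac12\chi_tx^2\partial_u,\qquad P^y(\rho)=\rho\,\partial_y-\tfrac12\rho_ty^2\partial_u,\\ &R^x(\alpha)=\alpha x\,\partial_u,\qquad R^y(\beta)=\beta y\,\partial_u,\qquad Z(\sigma)=\sigma\,\partial_u, \end{aligned} \] where $\tau,\chi,\rho,\alpha,\beta,\sigma$ run through the smooth functions of $t\in I$. (This is the Lie invariance algebra $\mathfrak g$ of the dispersionless Nizhnik equation $u_{txy}=(u_{xx}u_{xy})_x+(u_{xy}u_{yy})_y$.) Let $G$ be the pseudogroup (the point-symmetry pseudogroup of this equation)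 that is generated by the permutation $(t,x,y,u)\mapsto(t,y,x,u)$ of $x$ and $y$ and by the transformations \[ \begin{aligned} &\tilde t=T(t),\qquad \tilde x=CT_t^{1/3}x+X^0(t),\qquad \tilde y=CT_t^{1/3}y+Y^0(t),\\ &\tilde u=C^3u-\frac{C^3T_{tt}}{18T_t}(x^3+y^3)-\frac{C^2}{2T_t^{1/3}}(X^0_tx^2+Y^0_ty^2)+W^1(t)x+W^2(t)y+W^0(t), \end{aligned} \] where $C\neq0$ is a constant, $T,X^0,Y^0,W^0,W^1,W^2$ are smooth functions on an interval, $T_t\ne0$ everywhere on it, and $T_t^{1/3}$ is the real cube root. Subalgebras $\mathfrak s\subset\mathfrak g(I)$ and $\mathfrak s'\subset\mathfrak g(J)$ are *$G$-equivalent* if $\Phi_*\mathfrak s=\mathfrak s'$ for some $\Phi\in G$ that maps $I\times\mathbb R^3$ onto $J\times\mathbb R^3$. Consider, over any interval $I$, the subalgebras \[ \begin{aligned} &\mathfrak s_{1.1}^\delta=\langle D^t(1)+\delta D^{\rm s}\rangle,\quad \mathfrak s_{1.2}=\langle D^{\rm s}\rangle,\quad \mathfrak s_{1.3}^\rho=\langle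 P^x(1)+P^y(\rho)\rangle,\quad \mathfrak s_{1.4}^\beta=\langle P^x(1)+R^y(\beta)\rangle,\\ &\mathfrak s_{1.5}^\beta=\langle R^x(1)+R^y(\beta)\rangle,\quad \mathfrak s_{1.6}=\langle Z(t)\rangle,\quad \mathfrak s_{1.7}=\langle Z(1)\rangle, \end{aligned} \] where $\delta\in\{0,1\}$, and $\rho$ and $\beta$ run through the smooth functions of $t\in I$, with $\rho$ not identically zero. Count $\mathfrak s_{1.1}^0$ and $\mathfrak s_{1.1}^1$ as two separate families. Then: 1. All these subalgebras are one-dimensional subalgebras of $\mathfrak g(I)$. 2. Locally, every one-dimensional subalgebra is $G$-equivalent to a member of exactly one of the families: for every interval $I$, every one-dimensional subalgebra $\mathfrak s$ of $\mathfrak g(I)$ and every interval $I_0\subseteq I$ such that $\mathfrak s$ does not vanish identically over $I_0$, there is an interval $J\subseteq I_0$ such that the restriction of $\mathfrak s$ to $J\times\mathbb R^3$ is a one-dimensional subalgebra of $\mathfrak g(J)$ and is $G$-equivalent to a member (over some interval $J'$) of exactly one of the families. 3. Members of different families, over any intervals $I$ and $J$, are never $G$-equivalent. -/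

import Mathlib

open scoped ContDiff

namespace Nizhnik

noncomputable section

/-- Nonempty open intervals of the `t`-line, bounded or not. -/
structure IsOpenInterval (I : Set ℝ) : Prop where
  nonempty : I.Nonempty
  isOpen : IsOpen I
  ordConnected : I.OrdConnected

/-- The space with coordinates `(t, x, y, u)`. -/
abbrev Pt : Type := ℝ × ℝ × ℝ × ℝ

/-- The domain `I × ℝ³` in the space with coordinates `(t, x, y, u)`. -/
def slab (I : Set ℝ) : Set Pt := {p | p.1 ∈ I}

/-! Vector fields on the open set `I × ℝ³` are represented by functions `Pt → Pt` (the components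
along `∂_t, ∂_x, ∂_y, ∂_u`) with the value `0` outside of `I × ℝ³`, so that two vector fields are
equal as functions if and only if they coincide on `I × ℝ³`. -/

/-- `D^t(τ) = τ ∂_t + (1/3) τ_t x ∂_x + (1/3) τ_t y ∂_y - (1/18) τ_tt (x³ + y³) ∂_u`. -/
def Dt (I : Set ℝ) (τ : ℝ → ℝ) : Pt → Pt :=
  (slab I).indicator fun p =>
    (τ p.1, 1 / 3 * deriv τ p.1 * p.2.1, 1 / 3 * deriv τ p.1 * p.2.2.1,
      -(1 / 18) * deriv (deriv τ) p.1 * (p.2.1 ^ 3 + p.2.2.1 ^ 3))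

/-- `D^s = x ∂_x + y ∂_y + 3 u ∂_u`. -/
def Ds (I : Set ℝ) : Pt → Pt :=
  (slab I).indicator fun p => (0, p.2.1, p.2.2.1, 3 * p.2.2.2)

/-- `P^x(χ) = χ ∂_x - (1/2) χ_t x² ∂_u`. -/
def Px (I : Set ℝ) (χ : ℝ → ℝ) : Pt → Pt :=
  (slab I).indicator fun p => (0, χ p.1, 0, -(1 / 2) * deriv χ p.1 * p.2.1 ^ 2)

/-- `P^y(ρ) = ρ ∂_y - (1/2) ρ_t y² ∂_u`. -/
def Py (I : Set ℝ) (ρ : ℝ → ℝ) : Pt → Pt :=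
  (slab I).indicator fun p => (0, 0, ρ p.1, -(1 / 2) * deriv ρ p.1 * p.2.2.1 ^ 2)

/-- `R^x(α) = α x ∂_u`. -/
def Rx (I : Set ℝ) (α : ℝ → ℝ) : Pt → Pt :=
  (slab I).indicator fun p => (0, 0, 0, α p.1 * p.2.1)

/-- `R^y(β) = β y ∂_u`. -/
def Ry (I : Set ℝ) (β : ℝ → ℝ) : Pt → Pt :=
  (slab I).indicator fun p => (0, 0, 0, β p.1 * p.2.2.1)

/-- `Z(σ) = σ ∂_u`. -/
def Z (I : Set ℝ) (σ : ℝ → ℝ) : Pt → Pt :=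
  (slab I).indicator fun p => (0, 0, 0, σ p.1)

/-- Smooth functions of `t ∈ I`. -/
def SmoothOn (I : Set ℝ) (f : ℝ → ℝ) : Prop := ContDiffOn ℝ ∞ f I

/-- The Lie invariance algebra `𝔤` of the dispersionless Nizhnik equation
`u_txy = (u_xx u_xy)_x + (u_xy u_yy)_y` over the interval `I`: the span of the vector fields
`D^t(τ)`, `D^s`, `P^x(χ)`, `P^y(ρ)`, `R^x(α)`, `R^y(β)`, `Z(σ)`, where the parameters run through
the smooth functions of `t ∈ I`. -/
def algebra (I : Set ℝ) : Submodule ℝ (Pt → Pt) :=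
  Submodule.span ℝ
    ({V | ∃ τ, SmoothOn I τ ∧ V = Dt I τ} ∪ {Ds I} ∪
      {V | ∃ χ, SmoothOn I χ ∧ V = Px I χ} ∪ {V | ∃ ρ, SmoothOn I ρ ∧ V = Py I ρ} ∪
      {V | ∃ α, SmoothOn I α ∧ V = Rx I α} ∪ {V | ∃ β, SmoothOn I β ∧ V = Ry I β} ∪
      {V | ∃ σ, SmoothOn I σ ∧ V = Z I σ})

/-- One-dimensional subalgebras of `𝔤` over `I`: one-dimensional subspaces of `𝔤` that are closed
under the Lie bracket of vector fields. -/
structure IsOneDimSubalgebra (I : Set ℝ) (𝔰 : Submodule ℝ (Pt → Pt)) : Prop where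
  le : 𝔰 ≤ algebra I
  bracket_mem : ∀ V ∈ 𝔰, ∀ W ∈ 𝔰, VectorField.lieBracket ℝ V W ∈ 𝔰
  finrank_eq_one : Module.finrank ℝ 𝔰 = 1

/-- Restriction of vector fields to `J × ℝ³`. -/
def restrict (J : Set ℝ) : (Pt → Pt) →ₗ[ℝ] (Pt → Pt) where
  toFun V := (slab J).indicator V
  map_add' V W := Set.indicator_add' (slab J) V W
  map_smul' c V := Set.indicator_const_smul (slab J) c V

/-- The real cube root, also of negative numbers. -/
def cbrt (a : ℝ) : ℝ := if 0 ≤ a then a ^ (1 / 3 : ℝ) else -(-a) ^ (1 / 3 : ℝ)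

/-- `PointSym I J Φ` says that `Φ` maps `I × ℝ³` onto `J × ℝ³` and belongs to the point-symmetry
pseudogroup `G` of the dispersionless Nizhnik equation, which is generated by the transformations
`t̃ = T(t)`, `x̃ = C T_t^{1/3} x + X⁰(t)`, `ỹ = C T_t^{1/3} y + Y⁰(t)`,
`ũ = C³ u - C³ T_tt / (18 T_t) (x³ + y³) - C² / (2 T_t^{1/3}) (X⁰_t x² + Y⁰_t y²)
  + W¹(t) x + W²(t) y + W⁰(t)`
and by the permutation of `x` and `y`. The inverses of these generators and their restrictions to
open subintervals are of the same form. Only the values of `Φ` on `I × ℝ³` are relevant. -/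
inductive PointSym : Set ℝ → Set ℝ → (Pt → Pt) → Prop
  | form {I J : Set ℝ} {Φ : Pt → Pt} (T X₀ Y₀ W₀ W₁ W₂ : ℝ → ℝ) (C : ℝ)
      (hI : IsOpenInterval I) (hT : SmoothOn I T) (hX₀ : SmoothOn I X₀) (hY₀ : SmoothOn I Y₀)
      (hW₀ : SmoothOn I W₀) (hW₁ : SmoothOn I W₁) (hW₂ : SmoothOn I W₂)
      (hT_t : ∀ t ∈ I, deriv T t ≠ 0) (hJ : T '' I = J) (hC : C ≠ 0)
      (hΦ : ∀ t ∈ I, ∀ x y u : ℝ, Φ (t, x, y, u) =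
        (T t,
          C * cbrt (deriv T t) * x + X₀ t,
          C * cbrt (deriv T t) * y + Y₀ t,
          C ^ 3 * u - C ^ 3 * deriv (deriv T) t / (18 * deriv T t) * (x ^ 3 + y ^ 3)
            - C ^ 2 / (2 * cbrt (deriv T t)) * (deriv X₀ t * x ^ 2 + deriv Y₀ t * y ^ 2)
            + W₁ t * x + W₂ t * y + W₀ t)) :
      PointSym I J Φ
  | swap {I : Set ℝ} {Φ : Pt → Pt} (hI : IsOpenInterval I)
      (hΦ : ∀ t ∈ I, ∀ x y u : ℝ, Φ (t, x, y, u) = (t, y, x, u)) :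
      PointSym I I Φ
  | comp {I J K : Set ℝ} {Φ Ψ : Pt → Pt} (hΦ : PointSym I J Φ) (hΨ : PointSym J K Ψ) :
      PointSym I K (Ψ ∘ Φ)

/-- `V'` is the pushforward `Φ_* V` of the vector field `V` on `I × ℝ³`. -/
def IsPushforward (I : Set ℝ) (Φ V V' : Pt → Pt) : Prop :=
  ∀ p ∈ slab I, V' (Φ p) = fderiv ℝ Φ p (V p)

/-- `𝔰` (over `I`) and `𝔰'` (over `J`) are `G`-equivalent: `Φ_* 𝔰 = 𝔰'` for some `Φ ∈ G` that maps
`I × ℝ³` onto `J × ℝ³`. -/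
def GEquivalent (I : Set ℝ) (𝔰 : Submodule ℝ (Pt → Pt))
    (J : Set ℝ) (𝔰' : Submodule ℝ (Pt → Pt)) : Prop :=
  ∃ Φ : Pt → Pt, PointSym I J Φ ∧
    (∀ V ∈ 𝔰, ∃ V' ∈ 𝔰', IsPushforward I Φ V V') ∧
    (∀ V' ∈ 𝔰', ∃ V ∈ 𝔰, IsPushforward I Φ V V')

/-- Labels of the families of subalgebras; the two values of the constant `δ ∈ {0, 1}` in the first
family have separate labels. -/
inductive Family : Type
  | s11 (δ : Fin 2)
  | s12
  | s13
  | s14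
  | s15
  | s16
  | s17

/-- `k.Mem I 𝔰` says that `𝔰` is a member, over the interval `I`, of the family with label `k`. -/
def Family.Mem (k : Family) (I : Set ℝ) (𝔰 : Submodule ℝ (Pt → Pt)) : Prop :=
  match k with
  | .s11 δ => 𝔰 = Submodule.span ℝ {Dt I (fun _ => 1) + ((δ : ℕ) : ℝ) • Ds I}
  | .s12 => 𝔰 = Submodule.span ℝ {Ds I}
  | .s13 => ∃ ρ : ℝ → ℝ, SmoothOn I ρ ∧ (∃ t ∈ I, ρ t ≠ 0) ∧
      𝔰 = Submodule.span ℝ {Px I (fun _ => 1) + Py I ρ}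
  | .s14 => ∃ β : ℝ → ℝ, SmoothOn I β ∧ 𝔰 = Submodule.span ℝ {Px I (fun _ => 1) + Ry I β}
  | .s15 => ∃ β : ℝ → ℝ, SmoothOn I β ∧ 𝔰 = Submodule.span ℝ {Rx I (fun _ => 1) + Ry I β}
  | .s16 => 𝔰 = Submodule.span ℝ {Z I (fun t => t)}
  | .s17 => 𝔰 = Submodule.span ℝ {Z I (fun _ => 1)}

end

end Nizhnik

/-! A one-dimensional subalgebra is spanned by one field with parameters (τ, λ, χ, ρ, α, β, σ), and
these are determined by the field (`Coeffs.EqSmul.of_vec_eq`). The action of G on the parameters can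
be written in closed form (`Transf.Sends`, `Transf.Sends.isPushforward`) and it is triangular. The
constant λ is fixed and τ is multiplied by T_t. If τ = λ = 0, then χ and ρ are multiplied by C
T_t^{1/3}; if moreover χ = ρ = 0, then α and β are multiplied by C² / T_t^{1/3}; if these vanish
too, σ is multiplied by the constant C³. The permutation exchanges χ with ρ and α with β.

Inequivalence follows: the first parameters in this order that do not vanish identically, up to the
permutation, are invariant under G and under scaling of the field, and so is constancy of σ when
only σ is left. `HasType` records this information. Types are exclusive (`HasType.unique`), they
exhaust the nonzero fields (`HasType.exists_of_ne_zero`), and `PointSym.preservesTypes` carries them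
along elements of G.

For existence, shrink the interval until the leading parameter vanishes nowhere, choose T to
normalize it, and remove the later parameters by shifts. If τ or λ is nonzero, the shifts solve
linear first-order equations (`Rel.remove_all`); otherwise antiderivatives and algebra suffice. The
case analysis is `normalizable_of_vec_ne_zero`. -/

namespace Nizhnik

noncomputable section

open Set Filter Topology

/-! ### Smooth functions on intervals of the t-line -/

section Calculus

variable {I J : Set ℝ} {f g : ℝ → ℝ} {t : ℝ}

namespace SmoothOn

theorem contDiffAt (hf : SmoothOn I f) (hI : IsOpen I) (ht : t ∈ I) : ContDiffAt ℝ ∞ f t :=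
  ContDiffOn.contDiffAt hf (hI.mem_nhds ht)

theorem differentiableAt (hf : SmoothOn I f) (hI : IsOpen I) (ht : t ∈ I) :
    DifferentiableAt ℝ f t :=
  (hf.contDiffAt hI ht).differentiableAt (by simp)

theorem hasDerivAt (hf : SmoothOn I f) (hI : IsOpen I) (ht : t ∈ I) :
    HasDerivAt f (deriv f t) t :=
  (hf.differentiableAt hI ht).hasDerivAt

theorem continuousOn (hf : SmoothOn I f) : ContinuousOn f I := ContDiffOn.continuousOn hf

theorem continuousAt (hf : SmoothOn I f) (hI : IsOpen I) (ht : t ∈ I) : ContinuousAt f t :=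
  hf.continuousOn.continuousAt (hI.mem_nhds ht)

theorem mono (hf : SmoothOn I f) (h : J ⊆ I) : SmoothOn J f := ContDiffOn.mono hf h

theorem congr (hf : SmoothOn I f) (h : ∀ t ∈ I, g t = f t) : SmoothOn I g :=
  ContDiffOn.congr hf h

theorem const (c : ℝ) : SmoothOn I fun _ => c := contDiffOn_const

theorem id : SmoothOn I fun t => t := contDiffOn_id

theorem add (hf : SmoothOn I f) (hg : SmoothOn I g) : SmoothOn I fun t => f t + g t :=
  ContDiffOn.add hf hg

theorem sub (hf : SmoothOn I f) (hg : SmoothOn I g) : SmoothOn I fun t => f t - g t :=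
  ContDiffOn.sub hf hg

theorem neg (hf : SmoothOn I f) : SmoothOn I fun t => -f t := ContDiffOn.neg hf

theorem mul (hf : SmoothOn I f) (hg : SmoothOn I g) : SmoothOn I fun t => f t * g t :=
  ContDiffOn.mul hf hg

theorem pow (hf : SmoothOn I f) (n : ℕ) : SmoothOn I fun t => f t ^ n := ContDiffOn.pow hf n

theorem div (hf : SmoothOn I f) (hg : SmoothOn I g) (h0 : ∀ t ∈ I, g t ≠ 0) :
    SmoothOn I fun t => f t / g t :=
  ContDiffOn.div hf hg h0

theorem comp {φ : ℝ → ℝ} (hf : SmoothOn I f) (hφ : SmoothOn J φ) (h : ∀ t ∈ J, φ t ∈ I) :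
    SmoothOn J fun t => f (φ t) :=
  ContDiffOn.comp hf hφ h

theorem deriv (hf : SmoothOn I f) (hI : IsOpen I) : SmoothOn I (deriv f) :=
  ContDiffOn.deriv_of_isOpen hf hI (by simp)

end SmoothOn

theorem deriv_eq_of_eqOn (hI : IsOpen I) (h : ∀ t ∈ I, f t = g t) (ht : t ∈ I) :
    deriv f t = deriv g t :=
  EventuallyEq.deriv_eq (eventually_of_mem (hI.mem_nhds ht) h)

theorem hasDerivAt_congr_on {d : ℝ} (hI : IsOpen I) (h : ∀ t ∈ I, f t = g t) (ht : t ∈ I)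
    (hg : HasDerivAt g d t) : HasDerivAt f d t :=
  hg.congr_of_eventuallyEq (eventually_of_mem (hI.mem_nhds ht) h)

/-! ### The real cube root -/

theorem cbrt_pow_three (a : ℝ) : cbrt a ^ 3 = a := by
  unfold cbrt
  split_ifs with h
  · rw [← Real.rpow_natCast, ← Real.rpow_mul h]; norm_num
  · have h' : 0 ≤ -a := by linarith
    have : ((-a) ^ (1 / 3 : ℝ)) ^ 3 = -a := by
      rw [← Real.rpow_natCast, ← Real.rpow_mul h']; norm_num
    linear_combination -this

theorem pow_three_injective : Function.Injective fun x : ℝ => x ^ 3 :=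
  (Odd.strictMono_pow (by decide)).injective

theorem cbrt_cube (r : ℝ) : cbrt (r ^ 3) = r :=
  pow_three_injective (cbrt_pow_three (r ^ 3))

theorem cbrt_one : cbrt 1 = 1 := by simpa using cbrt_cube 1

theorem cbrt_ne_zero {a : ℝ} (ha : a ≠ 0) : cbrt a ≠ 0 := fun h => ha <| by
  rw [← cbrt_pow_three a, h]; norm_num

/-- Smoothness fails at 0 itself; near a nonzero point only one branch of the definition is active.
-/
theorem contDiffAt_cbrt {a : ℝ} (ha : a ≠ 0) : ContDiffAt ℝ ∞ cbrt a := by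
  rcases ha.lt_or_gt with h | h
  · have : ContDiffAt ℝ ∞ (fun a : ℝ => -(-a) ^ (1 / 3 : ℝ)) a :=
      (contDiffAt_id.neg.rpow_const_of_ne (by simpa using ha)).neg
    refine this.congr_of_eventuallyEq ?_
    filter_upwards [Iio_mem_nhds h] with b hb
    exact if_neg (not_le.2 hb)
  · refine (Real.contDiffAt_rpow_const_of_ne (p := 1 / 3) ha).congr_of_eventuallyEq ?_
    filter_upwards [Ioi_mem_nhds h] with b hb
    exact if_pos (le_of_lt hb)

theorem SmoothOn.cbrt (hf : SmoothOn I f) (h0 : ∀ t ∈ I, f t ≠ 0) :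
    SmoothOn I fun t => cbrt (f t) := fun t ht =>
  (contDiffAt_cbrt (h0 t ht)).comp_contDiffWithinAt t (hf t ht)

/-! ### Antiderivatives and linear equations of the first order -/

theorem exists_antiderivative (hI : IsOpenInterval I) (hg : SmoothOn I g) :
    ∃ f, SmoothOn I f ∧ ∀ t ∈ I, deriv f t = g t := by
  obtain ⟨a, ha⟩ := hI.nonempty
  have key : ∀ t ∈ I, HasDerivAt (fun t => ∫ s in a..t, g s) (g t) t := fun t ht =>
    intervalIntegral.integral_hasDerivAt_right
      (hg.continuousOn.mono (hI.ordConnected.uIcc_subset ha ht)).intervalIntegrable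
      (hg.continuousOn.stronglyMeasurableAtFilter hI.isOpen t ht)
      (hg.continuousAt hI.isOpen ht)
  refine ⟨fun t => ∫ s in a..t, g s, ?_, fun t ht => (key t ht).deriv⟩
  refine (contDiffOn_infty_iff_deriv_of_isOpen hI.isOpen).2
    ⟨fun t ht => (key t ht).differentiableAt.differentiableWithinAt, ?_⟩
  exact hg.congr fun t ht => (key t ht).deriv

/-- For κ ≠ 0 the integrating factor exp(-(μ/κ)t) reduces the equation to an antiderivative. For κ =
0 the equation is algebraic, and keeping this case lets τ ≠ 0 and τ = 0, λ ≠ 0 be treated together.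
-/
theorem exists_linear_ode_solution (hI : IsOpenInterval I) (hg : SmoothOn I g) {κ μ : ℝ}
    (h : κ ≠ 0 ∨ μ ≠ 0) : ∃ f, SmoothOn I f ∧ ∀ t ∈ I, κ * deriv f t = μ * f t + g t := by
  by_cases hκ : κ = 0
  · have hμ : μ ≠ 0 := h.resolve_left (not_not.2 hκ)
    refine ⟨fun t => -(1 / μ) * g t, (SmoothOn.const _).mul hg, fun t _ => ?_⟩
    rw [hκ]; field_simp; ring
  · have hexp : ∀ c : ℝ, SmoothOn I fun t => Real.exp (c * t) := fun c =>
      (contDiff_const.mul contDiff_id).exp.contDiffOn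
    obtain ⟨F, hF, hF'⟩ := exists_antiderivative hI
      (((hexp (-(μ / κ))).mul hg).mul (SmoothOn.const (1 / κ)))
    refine ⟨fun t => Real.exp (μ / κ * t) * F t, (hexp _).mul hF, fun t ht => ?_⟩
    have h1 : HasDerivAt (fun t => Real.exp (μ / κ * t)) (Real.exp (μ / κ * t) * (μ / κ)) t := by
      simpa using ((hasDerivAt_id t).const_mul (μ / κ)).exp
    have h2 : Real.exp (μ / κ * t) * Real.exp (-(μ / κ) * t) = 1 := by
      rw [← Real.exp_add]; simp
    have h3 : deriv (fun t => Real.exp (μ / κ * t) * F t) t = _ :=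
      (h1.mul (hF.hasDerivAt hI.isOpen ht)).deriv
    rw [h3, hF' t ht]
    field_simp
    field_simp at h2
    linear_combination g t * h2

/-! ### Changes of the independent variable -/

theorem injOn_of_deriv_ne_zero (hI : IsOpenInterval I) (hf : SmoothOn I f)
    (h0 : ∀ t ∈ I, deriv f t ≠ 0) : InjOn f I := by
  have key : ∀ a ∈ I, ∀ b ∈ I, a < b → f a ≠ f b := fun a ha b hb hab heq => by
    have hsub : Icc a b ⊆ I := hI.ordConnected.out ha hb
    obtain ⟨c, hc, hc'⟩ := exists_deriv_eq_zero hab (hf.continuousOn.mono hsub) heq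
    exact h0 c (hsub (Ioo_subset_Icc_self hc)) hc'
  intro a ha b hb heq
  rcases lt_trichotomy a b with h | h | h
  · exact absurd heq (key a ha b hb h)
  · exact h
  · exact absurd heq.symm (key b hb a ha h)

theorem IsOpenInterval.image (hI : IsOpenInterval I) (hf : SmoothOn I f)
    (h0 : ∀ t ∈ I, deriv f t ≠ 0) : IsOpenInterval (f '' I) where
  nonempty := hI.nonempty.image f
  ordConnected := (hI.ordConnected.isPreconnected.image f hf.continuousOn).ordConnected
  isOpen := isOpen_iff_mem_nhds.2 <| by
    rintro _ ⟨t, ht, rfl⟩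
    have hs : HasStrictDerivAt f (deriv f t) t :=
      (hf.contDiffAt hI.isOpen ht).hasStrictDerivAt (by simp)
    rw [← hs.map_nhds_eq (h0 t ht)]
    exact image_mem_map (hI.isOpen.mem_nhds ht)

/-- Rolle's theorem gives a global inverse on the image; it is smooth because near each point it
coincides with the local inverse of the inverse function theorem. -/
theorem exists_smooth_inverse (hI : IsOpenInterval I) (hf : SmoothOn I f)
    (h0 : ∀ t ∈ I, deriv f t ≠ 0) :
    ∃ S, SmoothOn (f '' I) S ∧ (∀ t ∈ I, S (f t) = t) ∧ ∀ s ∈ f '' I, S s ∈ I := by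
  have hinj := injOn_of_deriv_ne_zero hI hf h0
  have hS : ∀ t ∈ I, Function.invFunOn f I (f t) = t := fun t ht =>
    hinj.leftInvOn_invFunOn ht
  refine ⟨Function.invFunOn f I, ?_, hS, fun s hs => Function.invFunOn_mem hs⟩
  rintro _ ⟨t, ht, rfl⟩
  have hc := hf.contDiffAt hI.isOpen ht
  have hd : HasFDerivAt f ((ContinuousLinearEquiv.unitsEquivAut ℝ (Units.mk0 _ (h0 t ht)) :
      ℝ ≃L[ℝ] ℝ) : ℝ →L[ℝ] ℝ) t := by
    convert! (hf.hasDerivAt hI.isOpen ht).hasFDerivAt using 1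
  have hn : (∞ : WithTop ℕ∞) ≠ 0 := by simp
  have hg := hc.to_localInverse hd hn
  refine (hg.congr_of_eventuallyEq ?_).contDiffWithinAt
  have hst := hc.hasStrictFDerivAt' hd hn
  have hI' : ∀ᶠ s in 𝓝 (f t), hc.localInverse hd hn s ∈ I := by
    have := hg.continuousAt.eventually_mem (s := I)
      (by rw [hc.localInverse_apply_image]; exact hI.isOpen.mem_nhds ht)
    exact this
  filter_upwards [hI', hst.eventually_right_inverse] with s hs hs'
  change f (hc.localInverse hd hn s) = s at hs'
  conv_lhs => rw [← hs']
  exact hS _ hs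

/-- This is the shrinking step of the local classification: a parameter nonzero at one point is
nonzero on an interval around it. -/
theorem exists_isOpenInterval_forall (hI : IsOpenInterval I) (ht : t ∈ I) {P : ℝ → Prop}
    (h : ∀ᶠ s in 𝓝 t, P s) : ∃ J ⊆ I, IsOpenInterval J ∧ t ∈ J ∧ ∀ s ∈ J, P s := by
  obtain ⟨ε, hε, h'⟩ := Metric.eventually_nhds_iff_ball.1 (h.and (hI.isOpen.mem_nhds ht))
  refine ⟨Metric.ball t ε, fun s hs => (h' s hs).2, ⟨⟨t, Metric.mem_ball_self hε⟩,
    Metric.isOpen_ball, ?_⟩, Metric.mem_ball_self hε, fun s hs => (h' s hs).1⟩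
  exact (convex_ball t ε).ordConnected

end Calculus

/-! ### Parametrization of the algebra -/

/-- The parameters of the vector field
`D^t(τ) + λ D^s + P^x(χ) + P^y(ρ) + R^x(α) + R^y(β) + Z(σ)`. -/
structure Coeffs where
  τ : ℝ → ℝ
  lam : ℝ
  χ : ℝ → ℝ
  ρ : ℝ → ℝ
  α : ℝ → ℝ
  β : ℝ → ℝ
  σ : ℝ → ℝ

/-- All parameter functions are smooth functions of `t ∈ I`. -/
structure Coeffs.Smooth (I : Set ℝ) (c : Coeffs) : Prop where
  τ : SmoothOn I c.τ
  χ : SmoothOn I c.χ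
  ρ : SmoothOn I c.ρ
  α : SmoothOn I c.α
  β : SmoothOn I c.β
  σ : SmoothOn I c.σ

theorem Coeffs.Smooth.mono {I J : Set ℝ} {c : Coeffs} (hc : c.Smooth I) (h : J ⊆ I) :
    c.Smooth J :=
  ⟨hc.τ.mono h, hc.χ.mono h, hc.ρ.mono h, hc.α.mono h, hc.β.mono h, hc.σ.mono h⟩

/-- The components at a point of the vector field with parameters `c`. -/
def Coeffs.field (c : Coeffs) (p : Pt) : Pt :=
  (c.τ p.1,
    (1 / 3 * deriv c.τ p.1 + c.lam) * p.2.1 + c.χ p.1,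
    (1 / 3 * deriv c.τ p.1 + c.lam) * p.2.2.1 + c.ρ p.1,
    3 * c.lam * p.2.2.2 - 1 / 18 * deriv (deriv c.τ) p.1 * (p.2.1 ^ 3 + p.2.2.1 ^ 3)
      - 1 / 2 * deriv c.χ p.1 * p.2.1 ^ 2 - 1 / 2 * deriv c.ρ p.1 * p.2.2.1 ^ 2
      + c.α p.1 * p.2.1 + c.β p.1 * p.2.2.1 + c.σ p.1)

/-- `D^t(τ) + λ D^s + P^x(χ) + P^y(ρ) + R^x(α) + R^y(β) + Z(σ)` over `I`. -/
def vec (I : Set ℝ) (c : Coeffs) : Pt → Pt := (slab I).indicator c.field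

section

variable {I J : Set ℝ} {c d : Coeffs}

theorem vec_apply {p : Pt} (hp : p.1 ∈ I) : vec I c p = c.field p :=
  indicator_of_mem (s := slab I) hp _

theorem vec_apply_of_notMem {p : Pt} (hp : p.1 ∉ I) : vec I c p = 0 :=
  indicator_of_notMem (s := slab I) hp _

theorem vec_eq_add (I : Set ℝ) (c : Coeffs) :
    vec I c = Dt I c.τ + c.lam • Ds I + Px I c.χ + Py I c.ρ + Rx I c.α + Ry I c.β + Z I c.σ := by
  funext p
  by_cases hp : p ∈ slab I
  · simp only [vec, Coeffs.field, Dt, Ds, Px, Py, Rx, Ry, Z, Pi.add_apply, Pi.smul_apply,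
      indicator_of_mem hp, Prod.smul_mk, Prod.mk_add_mk, smul_eq_mul]
    ext <;> simp only <;> ring
  · simp only [vec, Dt, Ds, Px, Py, Rx, Ry, Z, Pi.add_apply, Pi.smul_apply,
      indicator_of_notMem hp, smul_zero, add_zero]

theorem vec_mem_algebra (hc : c.Smooth I) : vec I c ∈ algebra I := by
  have hsub : ∀ {V : Pt → Pt}, V ∈ _ → V ∈ algebra I := fun h => Submodule.subset_span h
  rw [vec_eq_add]
  refine add_mem (add_mem (add_mem (add_mem (add_mem (add_mem ?_ (Submodule.smul_mem _ _ ?_))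
    ?_) ?_) ?_) ?_) ?_ <;> apply hsub
  · exact .inl (.inl (.inl (.inl (.inl (.inl ⟨_, hc.τ, rfl⟩)))))
  · exact .inl (.inl (.inl (.inl (.inl (.inr rfl)))))
  · exact .inl (.inl (.inl (.inl (.inr ⟨_, hc.χ, rfl⟩))))
  · exact .inl (.inl (.inl (.inr ⟨_, hc.ρ, rfl⟩)))
  · exact .inl (.inl (.inr ⟨_, hc.α, rfl⟩))
  · exact .inl (.inr ⟨_, hc.β, rfl⟩)
  · exact .inr ⟨_, hc.σ, rfl⟩

theorem vec_congr (hI : IsOpen I) (hτ : ∀ t ∈ I, c.τ t = d.τ t) (hl : c.lam = d.lam)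
    (hχ : ∀ t ∈ I, c.χ t = d.χ t) (hρ : ∀ t ∈ I, c.ρ t = d.ρ t) (hα : ∀ t ∈ I, c.α t = d.α t)
    (hβ : ∀ t ∈ I, c.β t = d.β t) (hσ : ∀ t ∈ I, c.σ t = d.σ t) : vec I c = vec I d := by
  refine indicator_congr fun p (hp : p.1 ∈ I) => ?_
  have hτ' : ∀ t ∈ I, deriv c.τ t = deriv d.τ t := fun t ht => deriv_eq_of_eqOn hI hτ ht
  simp only [Coeffs.field, hτ _ hp, hl, hχ _ hp, hρ _ hp, hα _ hp, hβ _ hp, hσ _ hp, hτ' _ hp,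
    deriv_eq_of_eqOn hI hτ' hp, deriv_eq_of_eqOn hI hχ hp, deriv_eq_of_eqOn hI hρ hp]

/-- Sums of parameters. -/
def Coeffs.add (c d : Coeffs) : Coeffs where
  τ t := c.τ t + d.τ t
  lam := c.lam + d.lam
  χ t := c.χ t + d.χ t
  ρ t := c.ρ t + d.ρ t
  α t := c.α t + d.α t
  β t := c.β t + d.β t
  σ t := c.σ t + d.σ t

/-- Multiples of parameters. -/
def Coeffs.smul (a : ℝ) (c : Coeffs) : Coeffs where
  τ t := a * c.τ t
  lam := a * c.lam
  χ t := a * c.χ t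
  ρ t := a * c.ρ t
  α t := a * c.α t
  β t := a * c.β t
  σ t := a * c.σ t

theorem Coeffs.Smooth.add (hc : c.Smooth I) (hd : d.Smooth I) : (c.add d).Smooth I :=
  ⟨hc.τ.add hd.τ, hc.χ.add hd.χ, hc.ρ.add hd.ρ, hc.α.add hd.α, hc.β.add hd.β, hc.σ.add hd.σ⟩

theorem Coeffs.Smooth.smul (a : ℝ) (hc : c.Smooth I) : (c.smul a).Smooth I :=
  ⟨(SmoothOn.const a).mul hc.τ, (SmoothOn.const a).mul hc.χ, (SmoothOn.const a).mul hc.ρ,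
    (SmoothOn.const a).mul hc.α, (SmoothOn.const a).mul hc.β, (SmoothOn.const a).mul hc.σ⟩

theorem vec_add (hI : IsOpen I) (hc : c.Smooth I) (hd : d.Smooth I) :
    vec I (c.add d) = vec I c + vec I d := by
  funext p
  by_cases hp : p.1 ∈ I
  · have key : ∀ {f g : ℝ → ℝ}, SmoothOn I f → SmoothOn I g → ∀ t ∈ I,
        deriv (fun s => f s + g s) t = deriv f t + deriv g t := fun hf hg t ht =>
      ((hf.hasDerivAt hI ht).add (hg.hasDerivAt hI ht)).deriv
    have h2 : deriv (deriv fun s => c.τ s + d.τ s) p.1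
        = deriv (deriv c.τ) p.1 + deriv (deriv d.τ) p.1 := by
      rw [deriv_eq_of_eqOn hI (key hc.τ hd.τ) hp, key (hc.τ.deriv hI) (hd.τ.deriv hI) _ hp]
    simp only [Pi.add_apply, vec_apply hp, Coeffs.field, Coeffs.add, key hc.τ hd.τ _ hp, h2,
      key hc.χ hd.χ _ hp, key hc.ρ hd.ρ _ hp, Prod.mk_add_mk]
    ext <;> simp only <;> ring
  · simp [vec_apply_of_notMem hp]

theorem vec_smul (I : Set ℝ) (a : ℝ) (c : Coeffs) : vec I (c.smul a) = a • vec I c := by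
  funext p
  by_cases hp : p.1 ∈ I
  · have key : ∀ f : ℝ → ℝ, deriv (fun s => a * f s) = fun s => a * deriv f s := fun f => by
      funext t; exact deriv_const_mul_field a
    simp only [Pi.smul_apply, vec_apply hp, Coeffs.field, Coeffs.smul, key, Prod.smul_mk,
      smul_eq_mul]
    ext <;> simp only <;> ring
  · simp [vec_apply_of_notMem hp]

/-- The zero parameters. -/
def Coeffs.zero : Coeffs := ⟨fun _ => 0, 0, fun _ => 0, fun _ => 0, fun _ => 0, fun _ => 0, fun _ => 0⟩

theorem Coeffs.smooth_zero : Coeffs.zero.Smooth I :=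
  ⟨.const 0, .const 0, .const 0, .const 0, .const 0, .const 0⟩

theorem vec_zero (I : Set ℝ) : vec I Coeffs.zero = 0 := by
  have : Coeffs.zero = Coeffs.zero.smul 0 := by simp [Coeffs.zero, Coeffs.smul]
  rw [this, vec_smul, zero_smul]

theorem fields_zero (I : Set ℝ) : Dt I (fun _ => 0) = 0 ∧ Px I (fun _ => 0) = 0 ∧
    Py I (fun _ => 0) = 0 ∧ Rx I (fun _ => 0) = 0 ∧ Ry I (fun _ => 0) = 0 ∧
    Z I (fun _ => 0) = 0 := by
  refine ⟨?_, ?_, ?_, ?_, ?_, ?_⟩ <;> funext p <;> rcases em (p ∈ slab I) with hp | hp <;>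
    simp [Dt, Px, Py, Rx, Ry, Z, hp]

theorem exists_eq_vec (hI : IsOpen I) {V : Pt → Pt} (hV : V ∈ algebra I) :
    ∃ c : Coeffs, c.Smooth I ∧ V = vec I c := by
  obtain ⟨h1, h2, h3, h4, h5, h6⟩ := fields_zero I
  have c0 : ∀ a : ℝ, SmoothOn I fun _ => a := SmoothOn.const
  induction hV using Submodule.span_induction with
  | mem V hV =>
    rcases hV with (((((⟨f, hf, rfl⟩ | rfl) | ⟨f, hf, rfl⟩) | ⟨f, hf, rfl⟩) | ⟨f, hf, rfl⟩) |
      ⟨f, hf, rfl⟩) | ⟨f, hf, rfl⟩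
    · exact ⟨⟨f, 0, fun _ => 0, fun _ => 0, fun _ => 0, fun _ => 0, fun _ => 0⟩,
        ⟨hf, c0 0, c0 0, c0 0, c0 0, c0 0⟩, by rw [vec_eq_add]; simp [*]⟩
    · exact ⟨⟨fun _ => 0, 1, fun _ => 0, fun _ => 0, fun _ => 0, fun _ => 0, fun _ => 0⟩,
        ⟨c0 0, c0 0, c0 0, c0 0, c0 0, c0 0⟩, by rw [vec_eq_add]; simp [*]⟩
    · exact ⟨⟨fun _ => 0, 0, f, fun _ => 0, fun _ => 0, fun _ => 0, fun _ => 0⟩,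
        ⟨c0 0, hf, c0 0, c0 0, c0 0, c0 0⟩, by rw [vec_eq_add]; simp [*]⟩
    · exact ⟨⟨fun _ => 0, 0, fun _ => 0, f, fun _ => 0, fun _ => 0, fun _ => 0⟩,
        ⟨c0 0, c0 0, hf, c0 0, c0 0, c0 0⟩, by rw [vec_eq_add]; simp [*]⟩
    · exact ⟨⟨fun _ => 0, 0, fun _ => 0, fun _ => 0, f, fun _ => 0, fun _ => 0⟩,
        ⟨c0 0, c0 0, c0 0, hf, c0 0, c0 0⟩, by rw [vec_eq_add]; simp [*]⟩
    · exact ⟨⟨fun _ => 0, 0, fun _ => 0, fun _ => 0, fun _ => 0, f, fun _ => 0⟩,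
        ⟨c0 0, c0 0, c0 0, c0 0, hf, c0 0⟩, by rw [vec_eq_add]; simp [*]⟩
    · exact ⟨⟨fun _ => 0, 0, fun _ => 0, fun _ => 0, fun _ => 0, fun _ => 0, f⟩,
        ⟨c0 0, c0 0, c0 0, c0 0, c0 0, hf⟩, by rw [vec_eq_add]; simp [*]⟩
  | zero => exact ⟨_, Coeffs.smooth_zero, (vec_zero I).symm⟩
  | add V W _ _ hV hW =>
    obtain ⟨c, hc, rfl⟩ := hV
    obtain ⟨d, hd, rfl⟩ := hW
    exact ⟨_, hc.add hd, (vec_add hI hc hd).symm⟩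
  | smul a V _ hV =>
    obtain ⟨c, hc, rfl⟩ := hV
    exact ⟨_, hc.smul a, (vec_smul I a c).symm⟩

theorem restrict_vec (h : J ⊆ I) : restrict J (vec I c) = vec J c := by
  funext p
  change (slab J).indicator (vec I c) p = _
  by_cases hp : p.1 ∈ J
  · rw [indicator_of_mem (s := slab J) hp, vec_apply hp, vec_apply (h hp)]
  · rw [indicator_of_notMem (s := slab J) hp, vec_apply_of_notMem hp]

/-- The parameters `c` over `I` are `a` times the parameters `d`. -/
structure Coeffs.EqSmul (I : Set ℝ) (a : ℝ) (c d : Coeffs) : Prop where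
  τ : ∀ t ∈ I, c.τ t = a * d.τ t
  lam : c.lam = a * d.lam
  χ : ∀ t ∈ I, c.χ t = a * d.χ t
  ρ : ∀ t ∈ I, c.ρ t = a * d.ρ t
  α : ∀ t ∈ I, c.α t = a * d.α t
  β : ∀ t ∈ I, c.β t = a * d.β t
  σ : ∀ t ∈ I, c.σ t = a * d.σ t

/-- The values at (t, 0, 0, 0) give τ, χ, ρ and σ, the point with u = 1 gives λ, and the points with
x = 1 or y = 1 give α and β once the derivatives of the other parameters are known to agree. -/
theorem Coeffs.EqSmul.of_vec_eq (hI : IsOpenInterval I) {a : ℝ} (h : vec I c = a • vec I d) :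
    Coeffs.EqSmul I a c d := by
  rw [← vec_smul] at h
  have hf : ∀ t ∈ I, ∀ x y u : ℝ, c.field (t, x, y, u) = (d.smul a).field (t, x, y, u) :=
    fun t ht x y u => by
      have := congrFun h (t, x, y, u)
      rwa [vec_apply ht, vec_apply ht] at this
  have hτ : ∀ t ∈ I, c.τ t = (d.smul a).τ t := fun t ht => congrArg Prod.fst (hf t ht 0 0 0)
  have hχ : ∀ t ∈ I, c.χ t = (d.smul a).χ t := fun t ht => by
    simpa [Coeffs.field] using congrArg (fun p : Pt => p.2.1) (hf t ht 0 0 0)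
  have hρ : ∀ t ∈ I, c.ρ t = (d.smul a).ρ t := fun t ht => by
    simpa [Coeffs.field] using congrArg (fun p : Pt => p.2.2.1) (hf t ht 0 0 0)
  have hσ : ∀ t ∈ I, c.σ t = (d.smul a).σ t := fun t ht => by
    simpa [Coeffs.field] using congrArg (fun p : Pt => p.2.2.2) (hf t ht 0 0 0)
  have hl : c.lam = (d.smul a).lam := by
    obtain ⟨t, ht⟩ := hI.nonempty
    have := congrArg (fun p : Pt => p.2.2.2) (hf t ht 0 0 1)
    simp [Coeffs.field, hσ t ht] at this
    exact this
  have hτ' : ∀ t ∈ I, deriv c.τ t = deriv (d.smul a).τ t := fun t ht =>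
    deriv_eq_of_eqOn hI.isOpen hτ ht
  refine ⟨hτ, hl, hχ, hρ, fun t ht => ?_, fun t ht => ?_, hσ⟩
  · change c.α t = (d.smul a).α t
    have := congrArg (fun p : Pt => p.2.2.2) (hf t ht 1 0 0)
    simpa [Coeffs.field, hσ t ht, deriv_eq_of_eqOn hI.isOpen hτ' ht,
      deriv_eq_of_eqOn hI.isOpen hχ ht] using this
  · change c.β t = (d.smul a).β t
    have := congrArg (fun p : Pt => p.2.2.2) (hf t ht 0 1 0)
    simpa [Coeffs.field, hσ t ht, deriv_eq_of_eqOn hI.isOpen hτ' ht,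
      deriv_eq_of_eqOn hI.isOpen hρ ht] using this

end

/-! ### Pushforward of the fields by the generators of G -/

/-- The coefficients are arbitrary here, so that differentiation in four variables is separated from
the identities between the derivatives of T and of its cube root. -/
theorem exists_hasFDerivAt_triangular {T k X Y a b e W₁ W₂ W₀ : ℝ → ℝ}
    {T' k' X' Y' a' b' e' W₁' W₂' W₀' : ℝ} (n : ℝ) (p : Pt) (hT : HasDerivAt T T' p.1)
    (hk : HasDerivAt k k' p.1) (hX : HasDerivAt X X' p.1) (hY : HasDerivAt Y Y' p.1)
    (ha : HasDerivAt a a' p.1) (hb : HasDerivAt b b' p.1) (he : HasDerivAt e e' p.1)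
    (hW₁ : HasDerivAt W₁ W₁' p.1) (hW₂ : HasDerivAt W₂ W₂' p.1) (hW₀ : HasDerivAt W₀ W₀' p.1) :
    ∃ L : Pt →L[ℝ] Pt,
      HasFDerivAt (fun p : Pt => ((T p.1, k p.1 * p.2.1 + X p.1, k p.1 * p.2.2.1 + Y p.1,
        n * p.2.2.2 - a p.1 * (p.2.1 ^ 3 + p.2.2.1 ^ 3)
          - (b p.1 * p.2.1 ^ 2 + e p.1 * p.2.2.1 ^ 2)
          + W₁ p.1 * p.2.1 + W₂ p.1 * p.2.2.1 + W₀ p.1) : Pt)) L p ∧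
      ∀ v : Pt, L v = (T' * v.1, k' * v.1 * p.2.1 + k p.1 * v.2.1 + X' * v.1,
        k' * v.1 * p.2.2.1 + k p.1 * v.2.2.1 + Y' * v.1,
        n * v.2.2.2 - a' * v.1 * (p.2.1 ^ 3 + p.2.2.1 ^ 3)
          - a p.1 * (3 * p.2.1 ^ 2 * v.2.1 + 3 * p.2.2.1 ^ 2 * v.2.2.1)
          - (b' * v.1 * p.2.1 ^ 2 + b p.1 * (2 * p.2.1 * v.2.1)
            + (e' * v.1 * p.2.2.1 ^ 2 + e p.1 * (2 * p.2.2.1 * v.2.2.1)))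
          + (W₁' * v.1 * p.2.1 + W₁ p.1 * v.2.1) + (W₂' * v.1 * p.2.2.1 + W₂ p.1 * v.2.2.1)
          + W₀' * v.1) := by
  have pull : ∀ {f : ℝ → ℝ} {f' : ℝ}, HasDerivAt f f' p.1 →
      HasFDerivAt (fun p : Pt => f p.1) (f' • ContinuousLinearMap.fst ℝ ℝ (ℝ × ℝ × ℝ)) p :=
    fun hf => hf.comp_hasFDerivAt p hasFDerivAt_fst
  have h2 : HasFDerivAt (fun p : Pt => p.2) (.snd ℝ ℝ (ℝ × ℝ × ℝ)) p := hasFDerivAt_snd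
  have hx := h2.fst
  have hy := h2.snd.fst
  have hu := h2.snd.snd
  refine ⟨_, (pull hT).prodMk ((((pull hk).mul hx).add (pull hX)).prodMk
    ((((pull hk).mul hy).add (pull hY)).prodMk
      ((((((hu.const_mul n).sub ((pull ha).mul ((hx.pow 3).add (hy.pow 3)))).sub
        (((pull hb).mul (hx.pow 2)).add ((pull he).mul (hy.pow 2)))).add
        ((pull hW₁).mul hx)).add ((pull hW₂).mul hy)).add (pull hW₀)))), fun v => ?_⟩
  simp only [ContinuousLinearMap.prod_apply, add_apply,
    sub_apply, smul_apply, ContinuousLinearMap.comp_apply,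
    ContinuousLinearMap.coe_fst', ContinuousLinearMap.coe_snd', smul_eq_mul, nsmul_eq_mul,
    Pi.add_apply]
  ext <;> simp only <;> push_cast <;> ring

/-- The parameters of the transformations that generate `G` together with the permutation of `x`
and `y`. -/
structure Transf where
  T : ℝ → ℝ
  X₀ : ℝ → ℝ
  Y₀ : ℝ → ℝ
  W₀ : ℝ → ℝ
  W₁ : ℝ → ℝ
  W₂ : ℝ → ℝ
  C : ℝ

namespace Transf

/-- Admissible parameters over `I`. -/
structure Smooth (I : Set ℝ) (Θ : Transf) : Prop where
  T : SmoothOn I Θ.T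
  X₀ : SmoothOn I Θ.X₀
  Y₀ : SmoothOn I Θ.Y₀
  W₀ : SmoothOn I Θ.W₀
  W₁ : SmoothOn I Θ.W₁
  W₂ : SmoothOn I Θ.W₂
  deriv_T : ∀ t ∈ I, deriv Θ.T t ≠ 0
  C : Θ.C ≠ 0

/-- The transformation with the given parameters. -/
def map (Θ : Transf) (p : Pt) : Pt :=
  (Θ.T p.1,
    Θ.C * cbrt (deriv Θ.T p.1) * p.2.1 + Θ.X₀ p.1,
    Θ.C * cbrt (deriv Θ.T p.1) * p.2.2.1 + Θ.Y₀ p.1,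
    Θ.C ^ 3 * p.2.2.2
      - Θ.C ^ 3 * deriv (deriv Θ.T) p.1 / (18 * deriv Θ.T p.1) * (p.2.1 ^ 3 + p.2.2.1 ^ 3)
      - Θ.C ^ 2 / (2 * cbrt (deriv Θ.T p.1))
        * (deriv Θ.X₀ p.1 * p.2.1 ^ 2 + deriv Θ.Y₀ p.1 * p.2.2.1 ^ 2)
      + Θ.W₁ p.1 * p.2.1 + Θ.W₂ p.1 * p.2.2.1 + Θ.W₀ p.1)

/-- `T_t^{1/3}`. -/
def R (Θ : Transf) (t : ℝ) : ℝ := cbrt (deriv Θ.T t)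

/-- The coefficient `τ_t / 3 + τ T_tt / (3 T_t)`. -/
def rate (Θ : Transf) (τ : ℝ → ℝ) (t : ℝ) : ℝ :=
  1 / 3 * deriv τ t + τ t * (deriv Θ.R t / Θ.R t)

/-- The parameter of `P^x` or of `P^y` after a shift with the parameter `X`. -/
def newP (Θ : Transf) (τ : ℝ → ℝ) (l : ℝ) (X χ : ℝ → ℝ) (t : ℝ) : ℝ :=
  Θ.C * Θ.R t * χ t + deriv X t * τ t - (Θ.rate τ t + l) * X t

/-- The parameter of `R^x` or of `R^y` after a transformation with the parameters `X` and `W`. -/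
def newR (Θ : Transf) (τ : ℝ → ℝ) (l : ℝ) (X W χ α : ℝ → ℝ) (t : ℝ) : ℝ :=
  (Θ.C ^ 3 * α t - Θ.C ^ 2 * deriv X t * χ t / Θ.R t + τ t * deriv W t
      + W t * (1 / 3 * deriv τ t - 2 * l)) / (Θ.C * Θ.R t)
    + 1 / 2 * (deriv (Θ.rate τ) t / Θ.R t ^ 3) * X t ^ 2
    + deriv (Θ.newP τ l X χ) t / Θ.R t ^ 3 * X t

/-- The parameter of `Z` after the transformation. -/
def newZ (Θ : Transf) (c : Coeffs) (t : ℝ) : ℝ :=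
  Θ.C ^ 3 * c.σ t + Θ.W₁ t * c.χ t + Θ.W₂ t * c.ρ t + c.τ t * deriv Θ.W₀ t
    - 3 * c.lam * Θ.W₀ t
    + 1 / 6 * (deriv (Θ.rate c.τ) t / Θ.R t ^ 3) * (Θ.X₀ t ^ 3 + Θ.Y₀ t ^ 3)
    + 1 / 2 * (deriv (Θ.newP c.τ c.lam Θ.X₀ c.χ) t / Θ.R t ^ 3) * Θ.X₀ t ^ 2
    + 1 / 2 * (deriv (Θ.newP c.τ c.lam Θ.Y₀ c.ρ) t / Θ.R t ^ 3) * Θ.Y₀ t ^ 2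
    - Θ.newR c.τ c.lam Θ.X₀ Θ.W₁ c.χ c.α t * Θ.X₀ t
    - Θ.newR c.τ c.lam Θ.Y₀ Θ.W₂ c.ρ c.β t * Θ.Y₀ t

/-- The transformation maps the vector field with parameters `c` to that with parameters `d`. -/
structure Sends (I : Set ℝ) (Θ : Transf) (c d : Coeffs) : Prop where
  τ : ∀ t ∈ I, d.τ (Θ.T t) = Θ.R t ^ 3 * c.τ t
  lam : d.lam = c.lam
  χ : ∀ t ∈ I, d.χ (Θ.T t) = Θ.newP c.τ c.lam Θ.X₀ c.χ t
  ρ : ∀ t ∈ I, d.ρ (Θ.T t) = Θ.newP c.τ c.lam Θ.Y₀ c.ρ t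
  α : ∀ t ∈ I, d.α (Θ.T t) = Θ.newR c.τ c.lam Θ.X₀ Θ.W₁ c.χ c.α t
  β : ∀ t ∈ I, d.β (Θ.T t) = Θ.newR c.τ c.lam Θ.Y₀ Θ.W₂ c.ρ c.β t
  σ : ∀ t ∈ I, d.σ (Θ.T t) = Θ.newZ c t

variable {I : Set ℝ} {Θ : Transf} {c d : Coeffs} {t : ℝ}

theorem Smooth.R (h : Θ.Smooth I) (hI : IsOpen I) : SmoothOn I Θ.R :=
  (h.T.deriv hI).cbrt h.deriv_T

theorem R_pow_three (Θ : Transf) (t : ℝ) : Θ.R t ^ 3 = deriv Θ.T t := cbrt_pow_three _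

theorem Smooth.R_ne_zero (h : Θ.Smooth I) (ht : t ∈ I) : Θ.R t ≠ 0 :=
  cbrt_ne_zero (h.deriv_T t ht)

theorem Smooth.deriv_deriv_T (h : Θ.Smooth I) (hI : IsOpen I) (ht : t ∈ I) :
    deriv (deriv Θ.T) t = 3 * Θ.R t ^ 2 * deriv Θ.R t := by
  have h1 : deriv Θ.T = fun t => Θ.R t ^ 3 := funext fun s => (Θ.R_pow_three s).symm
  rw [h1]
  exact (((h.R hI).hasDerivAt hI ht).pow 3).deriv.trans (by norm_num)

theorem Smooth.rate {τ : ℝ → ℝ} (h : Θ.Smooth I) (hI : IsOpen I) (hτ : SmoothOn I τ) :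
    SmoothOn I (Θ.rate τ) :=
  ((SmoothOn.const _).mul (hτ.deriv hI)).add
    (hτ.mul (((h.R hI).deriv hI).div (h.R hI) fun _ ht => h.R_ne_zero ht))

theorem Smooth.newP {τ X χ : ℝ → ℝ} {l : ℝ} (h : Θ.Smooth I) (hI : IsOpen I)
    (hτ : SmoothOn I τ) (hX : SmoothOn I X) (hχ : SmoothOn I χ) :
    SmoothOn I (Θ.newP τ l X χ) :=
  ((((SmoothOn.const _).mul (h.R hI)).mul hχ).add ((hX.deriv hI).mul hτ)).sub
    (((h.rate hI hτ).add (SmoothOn.const _)).mul hX)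

theorem Smooth.newR {τ X W χ α : ℝ → ℝ} {l : ℝ} (h : Θ.Smooth I) (hI : IsOpen I)
    (hτ : SmoothOn I τ) (hX : SmoothOn I X) (hW : SmoothOn I W) (hχ : SmoothOn I χ)
    (hα : SmoothOn I α) : SmoothOn I (Θ.newR τ l X W χ α) := by
  have hR := h.R hI
  have hR0 : ∀ t ∈ I, Θ.R t ≠ 0 := fun _ ht => h.R_ne_zero ht
  have hR3 : ∀ t ∈ I, Θ.R t ^ 3 ≠ 0 := fun _ ht => pow_ne_zero 3 (hR0 _ ht)
  have k : ∀ a : ℝ, SmoothOn I fun _ => a := SmoothOn.const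
  exact ((((((((k _).mul hα).sub ((((k _).mul (hX.deriv hI)).mul hχ).div hR hR0)).add
    (hτ.mul (hW.deriv hI))).add (hW.mul (((k _).mul (hτ.deriv hI)).sub (k _)))).div
    ((k _).mul hR) fun t ht => mul_ne_zero h.C (hR0 t ht))).add
    (((k _).mul (((h.rate hI hτ).deriv hI).div (hR.pow 3) hR3)).mul (hX.pow 2))).add
    ((((h.newP hI hτ hX hχ).deriv hI).div (hR.pow 3) hR3).mul hX)

theorem Smooth.newZ (h : Θ.Smooth I) (hI : IsOpen I) (hc : c.Smooth I) :
    SmoothOn I (Θ.newZ c) := by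
  have hR := h.R hI
  have hR3 : ∀ t ∈ I, Θ.R t ^ 3 ≠ 0 := fun _ ht => pow_ne_zero 3 (h.R_ne_zero ht)
  have k : ∀ a : ℝ, SmoothOn I fun _ => a := SmoothOn.const
  have hrate := ((h.rate hI hc.τ).deriv hI).div (hR.pow 3) hR3
  exact (((((((((k _).mul hc.σ).add (h.W₁.mul hc.χ)).add (h.W₂.mul hc.ρ)).add
    (hc.τ.mul (h.W₀.deriv hI))).sub ((k _).mul h.W₀)).add
    (((k _).mul hrate).mul ((h.X₀.pow 3).add (h.Y₀.pow 3)))).add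
    (((k _).mul (((h.newP hI hc.τ h.X₀ hc.χ).deriv hI).div (hR.pow 3) hR3)).mul
      (h.X₀.pow 2))).add
    (((k _).mul (((h.newP hI hc.τ h.Y₀ hc.ρ).deriv hI).div (hR.pow 3) hR3)).mul
      (h.Y₀.pow 2))).sub
    ((h.newR hI hc.τ h.X₀ h.W₁ hc.χ hc.α).mul h.X₀) |>.sub
    ((h.newR hI hc.τ h.Y₀ h.W₂ hc.ρ hc.β).mul h.Y₀)

/-- The new parameters are prescribed as functions of the old variable t; composition with the
smooth inverse of T turns them into smooth functions of the new one. -/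
theorem Smooth.exists_sends (h : Θ.Smooth I) (hI : IsOpenInterval I) (hc : c.Smooth I) :
    ∃ d : Coeffs, d.Smooth (Θ.T '' I) ∧ Θ.Sends I c d := by
  obtain ⟨S, hS, hST, hSI⟩ := exists_smooth_inverse hI h.T h.deriv_T
  have ho := hI.isOpen
  refine ⟨⟨fun s => Θ.R (S s) ^ 3 * c.τ (S s), c.lam,
    fun s => Θ.newP c.τ c.lam Θ.X₀ c.χ (S s), fun s => Θ.newP c.τ c.lam Θ.Y₀ c.ρ (S s),
    fun s => Θ.newR c.τ c.lam Θ.X₀ Θ.W₁ c.χ c.α (S s),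
    fun s => Θ.newR c.τ c.lam Θ.Y₀ Θ.W₂ c.ρ c.β (S s), fun s => Θ.newZ c (S s)⟩, ?_, ?_⟩
  · exact ⟨(((h.R ho).pow 3).mul hc.τ).comp hS hSI, (h.newP ho hc.τ h.X₀ hc.χ).comp hS hSI,
      (h.newP ho hc.τ h.Y₀ hc.ρ).comp hS hSI, (h.newR ho hc.τ h.X₀ h.W₁ hc.χ hc.α).comp hS hSI,
      (h.newR ho hc.τ h.Y₀ h.W₂ hc.ρ hc.β).comp hS hSI, (h.newZ ho hc).comp hS hSI⟩
  · constructor <;> first | rfl | (intro t ht; simp only [hST t ht])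

theorem Smooth.exists_hasFDerivAt_map (h : Θ.Smooth I) (hI : IsOpen I) {p : Pt} (hp : p.1 ∈ I) :
    ∃ L : Pt →L[ℝ] Pt, HasFDerivAt Θ.map L p ∧ ∀ v : Pt,
      L v = (Θ.R p.1 ^ 3 * v.1,
        Θ.C * deriv Θ.R p.1 * v.1 * p.2.1 + Θ.C * Θ.R p.1 * v.2.1 + deriv Θ.X₀ p.1 * v.1,
        Θ.C * deriv Θ.R p.1 * v.1 * p.2.2.1 + Θ.C * Θ.R p.1 * v.2.2.1 + deriv Θ.Y₀ p.1 * v.1,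
        Θ.C ^ 3 * v.2.2.2
          - Θ.C ^ 3 / 6 * deriv (fun t => deriv Θ.R t / Θ.R t) p.1 * v.1
            * (p.2.1 ^ 3 + p.2.2.1 ^ 3)
          - Θ.C ^ 3 / 6 * (deriv Θ.R p.1 / Θ.R p.1)
            * (3 * p.2.1 ^ 2 * v.2.1 + 3 * p.2.2.1 ^ 2 * v.2.2.1)
          - ((Θ.C ^ 2 * (deriv (deriv Θ.X₀) p.1 * (2 * Θ.R p.1)
                - deriv Θ.X₀ p.1 * (2 * deriv Θ.R p.1)) / (2 * Θ.R p.1) ^ 2) * v.1 * p.2.1 ^ 2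
              + Θ.C ^ 2 * deriv Θ.X₀ p.1 / (2 * Θ.R p.1) * (2 * p.2.1 * v.2.1)
            + ((Θ.C ^ 2 * (deriv (deriv Θ.Y₀) p.1 * (2 * Θ.R p.1)
                - deriv Θ.Y₀ p.1 * (2 * deriv Θ.R p.1)) / (2 * Θ.R p.1) ^ 2) * v.1 * p.2.2.1 ^ 2
              + Θ.C ^ 2 * deriv Θ.Y₀ p.1 / (2 * Θ.R p.1) * (2 * p.2.2.1 * v.2.2.1)))
          + (deriv Θ.W₁ p.1 * v.1 * p.2.1 + Θ.W₁ p.1 * v.2.1)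
          + (deriv Θ.W₂ p.1 * v.1 * p.2.2.1 + Θ.W₂ p.1 * v.2.2.1)
          + deriv Θ.W₀ p.1 * v.1) := by
  have hR := (h.R hI).hasDerivAt hI hp
  have hR0 : Θ.R p.1 ≠ 0 := h.R_ne_zero hp
  have hQ : HasDerivAt (fun t => Θ.C ^ 3 / 6 * (deriv Θ.R t / Θ.R t)) _ p.1 :=
    ((((h.R hI).deriv hI).div (h.R hI) fun _ ht => h.R_ne_zero ht).hasDerivAt hI hp).const_mul
      (Θ.C ^ 3 / 6)
  -- With T_t = R³ the coefficient C³ T_tt / (18 T_t) equals (C³/6) R_t / R, and it is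
  -- differentiated in that form.
  have ha : HasDerivAt (fun t => Θ.C ^ 3 * deriv (deriv Θ.T) t / (18 * deriv Θ.T t))
      (Θ.C ^ 3 / 6 * deriv (fun t => deriv Θ.R t / Θ.R t) p.1) p.1 := by
    refine hasDerivAt_congr_on hI (fun t ht => ?_) hp hQ
    have := h.R_ne_zero ht
    rw [h.deriv_deriv_T hI ht, ← Θ.R_pow_three t]
    field_simp; ring
  have hb : ∀ {X : ℝ → ℝ}, SmoothOn I X →
      HasDerivAt (fun t => Θ.C ^ 2 * deriv X t / (2 * Θ.R t))
        (Θ.C ^ 2 * (deriv (deriv X) p.1 * (2 * Θ.R p.1)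
          - deriv X p.1 * (2 * deriv Θ.R p.1)) / (2 * Θ.R p.1) ^ 2) p.1 := fun {X} hX => by
    convert! (((hX.deriv hI).hasDerivAt hI hp).const_mul (Θ.C ^ 2)).div (hR.const_mul 2)
      (mul_ne_zero two_ne_zero hR0) using 1
    ring
  obtain ⟨L, hL, hLv⟩ := exists_hasFDerivAt_triangular (Θ.C ^ 3) p (h.T.hasDerivAt hI hp)
    (hR.const_mul Θ.C) (h.X₀.hasDerivAt hI hp) (h.Y₀.hasDerivAt hI hp) ha (hb h.X₀) (hb h.Y₀)
    (h.W₁.hasDerivAt hI hp) (h.W₂.hasDerivAt hI hp) (h.W₀.hasDerivAt hI hp)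
  refine ⟨L, ?_, fun v => ?_⟩
  · convert hL using 1
    funext q
    simp only [map, Transf.R]
    ext <;> simp only
    ring
  · rw [hLv v, ← Θ.R_pow_three]
    have : Θ.C ^ 3 * deriv (deriv Θ.T) p.1 / (18 * Θ.R p.1 ^ 3)
        = Θ.C ^ 3 / 6 * (deriv Θ.R p.1 / Θ.R p.1) := by
      rw [h.deriv_deriv_T hI hp]
      field_simp; ring
    rw [this]

theorem deriv_comp_T (h : Θ.Smooth I) (hI : IsOpenInterval I) {F G : ℝ → ℝ}
    (hF : SmoothOn (Θ.T '' I) F) (hFG : ∀ t ∈ I, F (Θ.T t) = G t) (ht : t ∈ I) :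
    deriv F (Θ.T t) = deriv G t / Θ.R t ^ 3 := by
  have hJ := (hI.image h.T h.deriv_T).isOpen
  have h1 := (hF.hasDerivAt hJ (mem_image_of_mem _ ht)).comp t (h.T.hasDerivAt hI.isOpen ht)
  have h2 : deriv G t = _ := (deriv_eq_of_eqOn hI.isOpen hFG ht).symm.trans h1.deriv
  rw [h2, Θ.R_pow_three, mul_div_cancel_right₀ _ (h.deriv_T t ht)]

/-- The formulas for the new parameters come from writing the pushed-forward components in the new
coordinates, for instance with C R x replaced by x̃ - X₀, and collecting powers. They are verified
in the old coordinates, where each component is a rational identity. -/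
theorem Sends.isPushforward (hs : Θ.Sends I c d) (h : Θ.Smooth I) (hI : IsOpenInterval I)
    (hc : c.Smooth I) (hd : d.Smooth (Θ.T '' I)) {Φ : Pt → Pt}
    (hΦ : ∀ p ∈ slab I, Φ p = Θ.map p) :
    IsPushforward I Φ (vec I c) (vec (Θ.T '' I) d) := by
  rintro p (hp : p.1 ∈ I)
  have ho := hI.isOpen
  have hJ := (hI.image h.T h.deriv_T).isOpen
  have hslab : slab I ∈ 𝓝 p := (ho.preimage continuous_fst).mem_nhds hp
  obtain ⟨L, hL, hLv⟩ := h.exists_hasFDerivAt_map ho hp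
  have hΦL : HasFDerivAt Φ L p := hL.congr_of_eventuallyEq (eventually_of_mem hslab hΦ)
  rw [hΦL.fderiv, hΦ p hp, vec_apply hp, hLv]
  have hT1 : (Θ.map p).1 = Θ.T p.1 := rfl
  rw [vec_apply (by rw [hT1]; exact mem_image_of_mem _ hp)]
  have hR0 := h.R_ne_zero hp
  have hC := h.C
  have hR := (h.R ho).hasDerivAt ho hp
  have hτ := hc.τ.hasDerivAt ho hp
  have hQ := (((h.R ho).deriv ho).div (h.R ho) fun _ ht => h.R_ne_zero ht).hasDerivAt ho hp
  have hrate : HasDerivAt (Θ.rate c.τ) (1 / 3 * deriv (deriv c.τ) p.1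
      + (deriv c.τ p.1 * (deriv Θ.R p.1 / Θ.R p.1)
        + c.τ p.1 * deriv (fun t => deriv Θ.R t / Θ.R t) p.1)) p.1 :=
    (((hc.τ.deriv ho).hasDerivAt ho hp).const_mul (1 / 3)).add (hτ.mul hQ)
  have dτ : ∀ t ∈ I, deriv d.τ (Θ.T t) = 3 * Θ.rate c.τ t := fun t ht => by
    have h1 := h.R_ne_zero ht
    rw [deriv_comp_T h hI hd.τ hs.τ ht]
    have h2 : deriv (fun t => Θ.R t ^ 3 * c.τ t) t = _ :=
      ((((h.R ho).hasDerivAt ho ht).pow 3).mul (hc.τ.hasDerivAt ho ht)).deriv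
    rw [h2, Transf.rate]
    simp only [Pi.pow_apply]
    field_simp
    push_cast
    ring
  have ddτ : deriv (deriv d.τ) (Θ.T p.1) = 3 * (deriv (Θ.rate c.τ) p.1 / Θ.R p.1 ^ 3) := by
    rw [deriv_comp_T h hI (hd.τ.deriv hJ) dτ hp, deriv_const_mul_field]
    ring
  have hP : ∀ {X χ : ℝ → ℝ}, SmoothOn I X → SmoothOn I χ →
      deriv (Θ.newP c.τ c.lam X χ) p.1
        = Θ.C * deriv Θ.R p.1 * χ p.1 + Θ.C * Θ.R p.1 * deriv χ p.1
          + (deriv (deriv X) p.1 * c.τ p.1 + deriv X p.1 * deriv c.τ p.1)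
          - (deriv (Θ.rate c.τ) p.1 * X p.1 + (Θ.rate c.τ p.1 + c.lam) * deriv X p.1) :=
    fun {X χ} hX hχ => by
      have hr := (hrate.differentiableAt.hasDerivAt).add_const c.lam
      exact ((((hR.const_mul Θ.C).mul (hχ.hasDerivAt ho hp)).add
        (((hX.deriv ho).hasDerivAt ho hp).mul hτ)).sub (hr.mul (hX.hasDerivAt ho hp))).deriv
  have dχ := deriv_comp_T h hI hd.χ hs.χ hp
  have dρ := deriv_comp_T h hI hd.ρ hs.ρ hp
  simp only [Coeffs.field, hT1, hs.τ _ hp, hs.lam, hs.χ _ hp, hs.ρ _ hp, hs.α _ hp, hs.β _ hp,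
    hs.σ _ hp, dτ _ hp, ddτ, dχ, dρ]
  simp only [map, Transf.newZ, Transf.newR, hP h.X₀ hc.χ, hP h.Y₀ hc.ρ, hrate.deriv]
  simp only [Transf.newP, Transf.rate]
  simp only [cbrt_cube, h.deriv_deriv_T ho hp, ← Θ.R_pow_three]
  refine Prod.ext ?_ (Prod.ext ?_ (Prod.ext ?_ ?_))
  · rfl
  · simp only
    field_simp
    ring
  · simp only
    field_simp
    ring
  · simp only
    field_simp
    ring

end Transf

/-! ### Types: the invariants that separate the families -/

/-- The conditions on the parameters that distinguish the vector fields that span, up to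
`G`-equivalence, a member of the family with label `k`. -/
def HasType (I : Set ℝ) (c : Coeffs) (k : Family) : Prop :=
  match k with
  | .s11 δ => (∃ t ∈ I, c.τ t ≠ 0) ∧ (c.lam = 0 ↔ δ = 0)
  | .s12 => (∀ t ∈ I, c.τ t = 0) ∧ c.lam ≠ 0
  | .s13 => (∀ t ∈ I, c.τ t = 0) ∧ c.lam = 0 ∧ (∃ t ∈ I, c.χ t ≠ 0) ∧ ∃ t ∈ I, c.ρ t ≠ 0
  | .s14 => (∀ t ∈ I, c.τ t = 0) ∧ c.lam = 0 ∧
      (((∃ t ∈ I, c.χ t ≠ 0) ∧ ∀ t ∈ I, c.ρ t = 0) ∨ ((∀ t ∈ I, c.χ t = 0) ∧ ∃ t ∈ I, c.ρ t ≠ 0))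
  | .s15 => (∀ t ∈ I, c.τ t = 0) ∧ c.lam = 0 ∧ (∀ t ∈ I, c.χ t = 0) ∧ (∀ t ∈ I, c.ρ t = 0) ∧
      ∃ t ∈ I, ¬(c.α t = 0 ∧ c.β t = 0)
  | .s16 => (∀ t ∈ I, c.τ t = 0) ∧ c.lam = 0 ∧ (∀ t ∈ I, c.χ t = 0) ∧ (∀ t ∈ I, c.ρ t = 0) ∧
      (∀ t ∈ I, c.α t = 0 ∧ c.β t = 0) ∧ ∃ s ∈ I, ∃ t ∈ I, c.σ s ≠ c.σ t
  | .s17 => (∀ t ∈ I, c.τ t = 0) ∧ c.lam = 0 ∧ (∀ t ∈ I, c.χ t = 0) ∧ (∀ t ∈ I, c.ρ t = 0) ∧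
      (∀ t ∈ I, c.α t = 0 ∧ c.β t = 0) ∧ (∀ s ∈ I, ∀ t ∈ I, c.σ s = c.σ t) ∧ ∃ t ∈ I, c.σ t ≠ 0

section

variable {I J : Set ℝ} {c d : Coeffs} {k k' : Family}

theorem HasType.unique (h : HasType I c k) (h' : HasType I c k') : k = k' := by
  cases k <;> cases k' <;> simp only [HasType] at h h' <;> try rfl
  · rename_i a b
    obtain ⟨-, h⟩ := h
    obtain ⟨-, h'⟩ := h'
    fin_cases a <;> fin_cases b <;> simp_all
  all_goals exfalso; grind

theorem HasType.exists_of_ne_zero (hI : IsOpenInterval I) (h : vec I c ≠ 0) :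
    ∃ k, HasType I c k := by
  by_contra! hn
  have n1 := hn (.s11 0)
  have n2 := hn (.s11 1)
  have n3 := hn .s12
  have n4 := hn .s13
  have n5 := hn .s14
  have n6 := hn .s15
  have n7 := hn .s16
  have n8 := hn .s17
  simp only [HasType] at n1 n2 n3 n4 n5 n6 n7 n8
  have hτ : ∀ t ∈ I, c.τ t = 0 := by
    by_contra! hne
    by_cases hl : c.lam = 0 <;> simp_all
  have hl : c.lam = 0 := by by_contra hne; exact n3 ⟨hτ, hne⟩
  have hχ : ∀ t ∈ I, c.χ t = 0 := by by_contra! hne; grind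
  have hρ : ∀ t ∈ I, c.ρ t = 0 := by by_contra! hne; grind
  have hα : ∀ t ∈ I, c.α t = 0 ∧ c.β t = 0 := by by_contra! hne; grind
  have hσ : ∀ t ∈ I, c.σ t = 0 := by by_contra! hne; grind
  exact h ((vec_congr hI.isOpen hτ hl hχ hρ (fun t ht => (hα t ht).1) (fun t ht => (hα t ht).2)
    hσ).trans (vec_zero I))

/-- Each hypothesis on a later parameter is required only when the earlier ones vanish, which is all
that a triangular action provides. For σ a common constant factor is needed, since constancy of σ
must be preserved as well as vanishing. -/
theorem HasType.transport {T : ℝ → ℝ} (hτ : ∀ t ∈ I, d.τ (T t) = 0 ↔ c.τ t = 0)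
    (hl : d.lam = 0 ↔ c.lam = 0)
    (hP : (∀ t ∈ I, c.τ t = 0) → c.lam = 0 → ∀ t ∈ I,
      (d.χ (T t) = 0 ↔ c.χ t = 0) ∧ (d.ρ (T t) = 0 ↔ c.ρ t = 0))
    (hR : (∀ t ∈ I, c.τ t = 0) → c.lam = 0 → (∀ t ∈ I, c.χ t = 0) → (∀ t ∈ I, c.ρ t = 0) →
      ∀ t ∈ I, (d.α (T t) = 0 ↔ c.α t = 0) ∧ (d.β (T t) = 0 ↔ c.β t = 0))
    (hZ : (∀ t ∈ I, c.τ t = 0) → c.lam = 0 → (∀ t ∈ I, c.χ t = 0) → (∀ t ∈ I, c.ρ t = 0) →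
      (∀ t ∈ I, c.α t = 0 ∧ c.β t = 0) → ∃ n ≠ 0, ∀ t ∈ I, d.σ (T t) = n * c.σ t)
    (h : HasType I c k) : HasType (T '' I) d k := by
  cases k <;> simp only [HasType, forall_mem_image, exists_mem_image] at h ⊢
  case s11 => grind
  case s12 => grind
  case s13 => grind
  case s14 => grind
  case s15 => grind
  case s16 =>
    obtain ⟨n, hn, hn'⟩ := hZ h.1 h.2.1 h.2.2.1 h.2.2.2.1 h.2.2.2.2.1
    obtain ⟨h1, h2, h3, h4, h5, s, hs, t, ht, hst⟩ := h
    refine ⟨by grind, by grind, by grind, by grind, by grind, s, hs, t, ht, ?_⟩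
    rw [hn' s hs, hn' t ht]
    exact fun h => hst (mul_left_cancel₀ hn h)
  case s17 =>
    obtain ⟨n, hn, hn'⟩ := hZ h.1 h.2.1 h.2.2.1 h.2.2.2.1 h.2.2.2.2.1
    obtain ⟨h1, h2, h3, h4, h5, h6, t, ht, hst⟩ := h
    refine ⟨by grind, by grind, by grind, by grind, by grind, ?_, t, ht, ?_⟩
    · intro s hs t ht
      rw [hn' s hs, hn' t ht, h6 s hs t ht]
    · rw [hn' t ht]
      exact mul_ne_zero hn hst

theorem HasType.ne_zero_of_eqSmul {a : ℝ} (h : Coeffs.EqSmul I a c d) (hk : HasType I c k) :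
    a ≠ 0 := by
  rintro rfl
  obtain ⟨h1, h2, h3, h4, h5, h6, h7⟩ := h
  simp only [zero_mul] at h1 h2 h3 h4 h5 h6 h7
  cases k <;> simp only [HasType] at hk <;> grind

theorem HasType.vec_ne_zero (hI : IsOpenInterval I) (hk : HasType I c k) : vec I c ≠ 0 := fun h =>
  hk.ne_zero_of_eqSmul (.of_vec_eq hI (by rw [zero_smul, h] : vec I c = (0 : ℝ) • vec I c)) rfl

/-- A zero factor would make all parameters of `c` vanish, which no type allows; scaling by a
nonzero factor is then transport along the identity of the t-line. -/
theorem HasType.of_eqSmul {a : ℝ} (h : Coeffs.EqSmul I a c d) (hk : HasType I c k) :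
    HasType I d k := by
  have ha : a ≠ 0 := hk.ne_zero_of_eqSmul h
  have key : ∀ {x y : ℝ}, x = a * y → (y = 0 ↔ x = 0) := fun hxy => by simp [hxy, ha]
  have := hk.transport (T := fun t => t) (d := d) (fun t ht => key (h.τ t ht)) (key h.lam)
    (fun _ _ t ht => ⟨key (h.χ t ht), key (h.ρ t ht)⟩)
    (fun _ _ _ _ t ht => ⟨key (h.α t ht), key (h.β t ht)⟩)
    (fun _ _ _ _ _ => ⟨a⁻¹, inv_ne_zero ha, fun t ht => by rw [h.σ t ht]; field_simp⟩)
  rwa [image_id'] at this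

/-- The effect of the permutation of `x` and `y`. -/
def Coeffs.swap (c : Coeffs) : Coeffs := ⟨c.τ, c.lam, c.ρ, c.χ, c.β, c.α, c.σ⟩

theorem HasType.swap (h : HasType I c k) : HasType I c.swap k := by
  cases k <;> simp only [HasType, Coeffs.swap] at h ⊢ <;> grind

namespace Transf

variable {Θ : Transf}

theorem Sends.hasType (hs : Θ.Sends I c d) (h : Θ.Smooth I) (hI : IsOpenInterval I)
    (hk : HasType I c k) : HasType (Θ.T '' I) d k := by
  have ho := hI.isOpen
  have hC := h.C
  -- Vanishing of τ removes `rate` and its derivative; with λ = 0 the shifts then drop out of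
  -- `newP`, and with χ = 0 also out of `newR`. Only the multiplicative factors remain.
  have hrate : (∀ t ∈ I, c.τ t = 0) → ∀ t ∈ I, Θ.rate c.τ t = 0 := fun h0 t ht => by
    have : deriv c.τ t = 0 := (deriv_eq_of_eqOn ho h0 ht).trans (deriv_const t 0)
    simp [Transf.rate, h0 t ht, this]
  have hrate' : (∀ t ∈ I, c.τ t = 0) → ∀ t ∈ I, deriv (Θ.rate c.τ) t = 0 := fun h0 t ht =>
    (deriv_eq_of_eqOn ho (hrate h0) ht).trans (deriv_const t 0)
  have hnewP : (∀ t ∈ I, c.τ t = 0) → c.lam = 0 → ∀ {X χ : ℝ → ℝ}, ∀ t ∈ I,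
      Θ.newP c.τ c.lam X χ t = Θ.C * Θ.R t * χ t := fun h0 hl X χ t ht => by
    simp [Transf.newP, h0 t ht, hl, hrate h0 t ht]
  have hnewR : (∀ t ∈ I, c.τ t = 0) → c.lam = 0 → ∀ {X W χ α : ℝ → ℝ}, (∀ t ∈ I, χ t = 0) →
      ∀ t ∈ I, Θ.newR c.τ c.lam X W χ α t = Θ.C ^ 3 * α t / (Θ.C * Θ.R t) :=
    fun h0 hl X W χ α hχ t ht => by
      have h1 : deriv (Θ.newP c.τ c.lam X χ) t = 0 :=
        (deriv_eq_of_eqOn (g := fun _ => 0) ho (fun s hs => by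
          rw [hnewP h0 hl s hs, hχ s hs, mul_zero]) ht).trans (deriv_const t 0)
      have h2 : deriv c.τ t = 0 := (deriv_eq_of_eqOn ho h0 ht).trans (deriv_const t 0)
      simp only [Transf.newR, h1]
      simp [h0 t ht, hl, hrate' h0 t ht, hχ t ht, h2]
  refine hk.transport (fun t ht => ?_) (by rw [hs.lam]) (fun h0 hl t ht => ?_)
    (fun h0 hl hχ hρ t ht => ?_) (fun h0 hl hχ hρ hαβ => ⟨Θ.C ^ 3, pow_ne_zero 3 hC, fun t ht => ?_⟩)
  · simp [hs.τ t ht, h.R_ne_zero ht]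
  · simp [hs.χ t ht, hs.ρ t ht, hnewP h0 hl t ht, hC, h.R_ne_zero ht]
  · simp [hs.α t ht, hs.β t ht, hnewR h0 hl hχ t ht, hnewR h0 hl hρ t ht, hC, h.R_ne_zero ht]
  · have hd : ∀ {X χ : ℝ → ℝ}, (∀ t ∈ I, χ t = 0) → deriv (Θ.newP c.τ c.lam X χ) t = 0 :=
      fun {X χ} hχ => (deriv_eq_of_eqOn (g := fun _ => 0) ho (fun s hs => by
          rw [hnewP h0 hl s hs, hχ s hs, mul_zero]) ht).trans (deriv_const t 0)
    simp only [hs.σ t ht, Transf.newZ, hd hχ, hd hρ, hnewR h0 hl hχ t ht, hnewR h0 hl hρ t ht]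
    simp [hχ t ht, hρ t ht, hαβ t ht, h0 t ht, hl, hrate' h0 t ht]

/-- The map is triangular: t, then x and y, then u, which enters affinely with the nonzero
coefficient C³. -/
theorem Smooth.exists_map_eq (h : Θ.Smooth I) {q : Pt} (hq : q ∈ slab (Θ.T '' I)) :
    ∃ p ∈ slab I, Θ.map p = q := by
  obtain ⟨s, x, y, u⟩ := q
  obtain ⟨t, ht, rfl⟩ : s ∈ Θ.T '' I := hq
  have hR : cbrt (deriv Θ.T t) ≠ 0 := h.R_ne_zero ht
  have hC := h.C
  set x' := (x - Θ.X₀ t) / (Θ.C * cbrt (deriv Θ.T t))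
  set y' := (y - Θ.Y₀ t) / (Θ.C * cbrt (deriv Θ.T t))
  refine ⟨(t, x', y', (u - (Θ.map (t, x', y', 0)).2.2.2) / Θ.C ^ 3), ht, ?_⟩
  simp only [map]
  refine Prod.ext rfl (Prod.ext ?_ (Prod.ext ?_ ?_))
  · simp only [x']; field_simp; ring
  · simp only [y']; field_simp; ring
  · simp only [mul_div_cancel₀ _ (pow_ne_zero 3 hC)]; ring

end Transf

/-! ### Invariance of types under G -/

/-- The data about an element of `G` that the classification uses. -/
structure PreservesTypes (I J : Set ℝ) (Φ : Pt → Pt) : Prop where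
  source : IsOpenInterval I
  target : IsOpenInterval J
  differentiableAt : ∀ p ∈ slab I, DifferentiableAt ℝ Φ p
  mapsTo : ∀ p ∈ slab I, Φ p ∈ slab J
  surjective : ∀ q ∈ slab J, ∃ p ∈ slab I, Φ p = q
  exists_pushforward : ∀ c : Coeffs, c.Smooth I → ∃ d : Coeffs, d.Smooth J ∧
    IsPushforward I Φ (vec I c) (vec J d) ∧ ∀ k, HasType I c k → HasType J d k

theorem eventuallyEq_of_slab (hI : IsOpen I) {Φ Ψ : Pt → Pt} (h : ∀ p ∈ slab I, Φ p = Ψ p)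
    {p : Pt} (hp : p ∈ slab I) : Φ =ᶠ[𝓝 p] Ψ :=
  eventually_of_mem ((hI.preimage continuous_fst).mem_nhds hp) h

/-- The permutation of `x` and `y` as a linear map. -/
def swapL : Pt →L[ℝ] Pt :=
  (ContinuousLinearMap.fst ℝ ℝ (ℝ × ℝ × ℝ)).prod
    (((ContinuousLinearMap.fst ℝ ℝ ℝ).comp ((ContinuousLinearMap.snd ℝ ℝ (ℝ × ℝ)).comp
      (ContinuousLinearMap.snd ℝ ℝ (ℝ × ℝ × ℝ)))).prod
    (((ContinuousLinearMap.fst ℝ ℝ (ℝ × ℝ)).comp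
      (ContinuousLinearMap.snd ℝ ℝ (ℝ × ℝ × ℝ))).prod
    ((ContinuousLinearMap.snd ℝ ℝ ℝ).comp ((ContinuousLinearMap.snd ℝ ℝ (ℝ × ℝ)).comp
      (ContinuousLinearMap.snd ℝ ℝ (ℝ × ℝ × ℝ))))))

theorem swapL_apply (p : Pt) : swapL p = (p.1, p.2.2.1, p.2.1, p.2.2.2) := rfl

theorem isPushforward_swap (hI : IsOpen I) {Φ : Pt → Pt} (hΦ : ∀ p ∈ slab I, Φ p = swapL p)
    (c : Coeffs) : IsPushforward I Φ (vec I c) (vec I c.swap) := by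
  rintro p (hp : p.1 ∈ I)
  rw [(swapL.hasFDerivAt.congr_of_eventuallyEq (eventuallyEq_of_slab hI hΦ hp)).fderiv, hΦ p hp,
    vec_apply (by exact hp), vec_apply hp]
  simp only [swapL_apply, Coeffs.field, Coeffs.swap]
  ext <;> simp only
  ring

theorem IsPushforward.comp {Φ Ψ V V' V'' : Pt → Pt} (hΦ : ∀ p ∈ slab I, DifferentiableAt ℝ Φ p)
    (hIJ : ∀ p ∈ slab I, Φ p ∈ slab J) (hΨ : ∀ p ∈ slab J, DifferentiableAt ℝ Ψ p)
    (h : IsPushforward I Φ V V') (h' : IsPushforward J Ψ V' V'') :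
    IsPushforward I (Ψ ∘ Φ) V V'' := fun p hp => by
  rw [fderiv_comp p (hΨ _ (hIJ p hp)) (hΦ p hp), Function.comp_apply, h' _ (hIJ p hp), h p hp]
  rfl

/-- Induction over the generators of G. The data are rich enough to compose: differentiability and
the mapping property feed the chain rule, and the image of a field has smooth parameters again. -/
theorem PointSym.preservesTypes {Φ : Pt → Pt} (h : PointSym I J Φ) : PreservesTypes I J Φ := by
  induction h with
  | @form I J Φ T X₀ Y₀ W₀ W₁ W₂ C hI hT hX₀ hY₀ hW₀ hW₁ hW₂ hT_t hJ hC hΦ =>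
    subst hJ
    let Θ : Transf := ⟨T, X₀, Y₀, W₀, W₁, W₂, C⟩
    have hΘ : Θ.Smooth I := ⟨hT, hX₀, hY₀, hW₀, hW₁, hW₂, hT_t, hC⟩
    have hmap : ∀ p ∈ slab I, Φ p = Θ.map p := fun p hp => hΦ p.1 hp p.2.1 p.2.2.1 p.2.2.2
    refine ⟨hI, hI.image hT hT_t, fun p hp => ?_, fun p hp => ?_, fun q hq => ?_, fun c hc => ?_⟩
    · obtain ⟨L, hL, -⟩ := hΘ.exists_hasFDerivAt_map hI.isOpen hp
      exact (hL.congr_of_eventuallyEq (eventuallyEq_of_slab hI.isOpen hmap hp)).differentiableAt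
    · rw [hmap p hp]
      exact mem_image_of_mem T hp
    · obtain ⟨p, hp, hpq⟩ := hΘ.exists_map_eq hq
      exact ⟨p, hp, (hmap p hp).trans hpq⟩
    · obtain ⟨d, hd, hs⟩ := hΘ.exists_sends hI hc
      exact ⟨d, hd, hs.isPushforward hΘ hI hc hd hmap, fun k hk => hs.hasType hΘ hI hk⟩
  | @swap I Φ hI hΦ =>
    have hmap : ∀ p ∈ slab I, Φ p = swapL p := fun p hp => hΦ p.1 hp p.2.1 p.2.2.1 p.2.2.2
    refine ⟨hI, hI, fun p hp => ?_, fun p hp => ?_, fun q hq => ?_, fun c hc => ?_⟩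
    · exact (swapL.hasFDerivAt.congr_of_eventuallyEq
        (eventuallyEq_of_slab hI.isOpen hmap hp)).differentiableAt
    · rw [hmap p hp]
      exact hp
    · exact ⟨swapL q, hq, hmap (swapL q) hq⟩
    · exact ⟨c.swap, ⟨hc.τ, hc.ρ, hc.χ, hc.β, hc.α, hc.σ⟩, isPushforward_swap hI.isOpen hmap c,
        fun k hk => hk.swap⟩
  | @comp I J K Φ Ψ _ _ h1 h2 =>
    refine ⟨h1.source, h2.target, fun p hp => ?_, fun p hp => h2.mapsTo _ (h1.mapsTo p hp),
      fun q hq => ?_, fun c hc => ?_⟩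
    · exact (h2.differentiableAt _ (h1.mapsTo p hp)).comp p (h1.differentiableAt p hp)
    · obtain ⟨r, hr, rfl⟩ := h2.surjective q hq
      obtain ⟨p, hp, rfl⟩ := h1.surjective r hr
      exact ⟨p, hp, rfl⟩
    · obtain ⟨d, hd, hp, hk⟩ := h1.exists_pushforward c hc
      obtain ⟨e, he, hp', hk'⟩ := h2.exists_pushforward d hd
      exact ⟨e, he, hp.comp h1.differentiableAt h1.mapsTo h2.differentiableAt hp',
        fun k h => hk' k (hk k h)⟩

/-- Surjectivity of Φ makes the pushforward unique, so the image computed from the parameters equals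
the multiple of `vec J d` that the equivalence provides; the type passes to `d` by scaling. -/
theorem GEquivalent.hasType (hc : c.Smooth I)
    (h : GEquivalent I (Submodule.span ℝ {vec I c}) J (Submodule.span ℝ {vec J d}))
    (hk : HasType I c k) : HasType J d k := by
  obtain ⟨Φ, hΦ, h1, -⟩ := h
  have hp := hΦ.preservesTypes
  obtain ⟨V', hV', hpush⟩ := h1 _ (Submodule.mem_span_singleton_self _)
  obtain ⟨a, rfl⟩ := Submodule.mem_span_singleton.1 hV'
  obtain ⟨e, -, hpush', hke⟩ := hp.exists_pushforward c hc
  refine HasType.of_eqSmul (a := a) (.of_vec_eq hp.target ?_) (hke k hk)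
  funext q
  by_cases hq : q ∈ slab J
  · obtain ⟨p, hp, rfl⟩ := hp.surjective q hq
    rw [hpush p hp, hpush' p hp]
  · have hq' : q.1 ∉ J := hq
    rw [vec_apply_of_notMem hq', Pi.smul_apply, vec_apply_of_notMem hq', smul_zero]

end

/-! ### Normal forms and the spans of single fields -/

/-- The parameters of the vector fields that span the members of the family with label `k`. -/
def Normal (I : Set ℝ) (k : Family) (c : Coeffs) : Prop :=
  match k with
  | .s11 δ => c = { Coeffs.zero with τ := fun _ => 1, lam := ((δ : ℕ) : ℝ) }
  | .s12 => c = { Coeffs.zero with lam := 1 }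
  | .s13 => ∃ ρ : ℝ → ℝ, SmoothOn I ρ ∧ (∃ t ∈ I, ρ t ≠ 0) ∧
      c = { Coeffs.zero with χ := fun _ => 1, ρ := ρ }
  | .s14 => ∃ β : ℝ → ℝ, SmoothOn I β ∧ c = { Coeffs.zero with χ := fun _ => 1, β := β }
  | .s15 => ∃ β : ℝ → ℝ, SmoothOn I β ∧ c = { Coeffs.zero with α := fun _ => 1, β := β }
  | .s16 => c = { Coeffs.zero with σ := fun t => t }
  | .s17 => c = { Coeffs.zero with σ := fun _ => 1 }

section

variable {I J K : Set ℝ} {c d e : Coeffs} {k : Family}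

theorem mem_iff_normal {𝔰 : Submodule ℝ (Pt → Pt)} :
    k.Mem I 𝔰 ↔ ∃ c, Normal I k c ∧ 𝔰 = Submodule.span ℝ {vec I c} := by
  obtain ⟨h1, h2, h3, h4, h5, h6⟩ := fields_zero I
  cases k <;> simp only [Family.Mem, Normal] <;>
    simp [vec_eq_add, Coeffs.zero, h1, h2, h3, h4, h5, h6, and_assoc]

theorem Normal.smooth (h : Normal I k c) : c.Smooth I := by
  have h0 : ∀ a : ℝ, SmoothOn I fun _ => a := SmoothOn.const
  cases k <;> simp only [Normal] at h
  case s13 => obtain ⟨ρ, hρ, -, rfl⟩ := h; exact ⟨h0 0, h0 1, hρ, h0 0, h0 0, h0 0⟩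
  case s14 => obtain ⟨β, hβ, rfl⟩ := h; exact ⟨h0 0, h0 1, h0 0, h0 0, hβ, h0 0⟩
  case s15 => obtain ⟨β, hβ, rfl⟩ := h; exact ⟨h0 0, h0 0, h0 0, h0 1, hβ, h0 0⟩
  case s16 => subst h; exact ⟨h0 0, h0 0, h0 0, h0 0, h0 0, SmoothOn.id⟩
  all_goals subst h; constructor <;> exact h0 _

theorem Normal.hasType (hI : IsOpenInterval I) (h : Normal I k c) : HasType I c k := by
  obtain ⟨t, ht⟩ := hI.nonempty
  cases k <;> simp only [Normal] at h
  case s13 =>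
    obtain ⟨ρ, hρ, hne, rfl⟩ := h
    exact ⟨fun _ _ => rfl, rfl, ⟨t, ht, one_ne_zero⟩, hne⟩
  case s14 =>
    obtain ⟨β, hβ, rfl⟩ := h
    exact ⟨fun _ _ => rfl, rfl, .inl ⟨⟨t, ht, one_ne_zero⟩, fun _ _ => rfl⟩⟩
  case s15 =>
    obtain ⟨β, hβ, rfl⟩ := h
    exact ⟨fun _ _ => rfl, rfl, fun _ _ => rfl, fun _ _ => rfl, t, ht, fun h => one_ne_zero h.1⟩
  case s16 =>
    subst h
    obtain ⟨s, hs, hst⟩ : ∃ s ∈ I, s ≠ t := by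
      obtain ⟨ε, hε, hball⟩ := Metric.isOpen_iff.1 hI.isOpen t ht
      refine ⟨t + ε / 2, hball ?_, by linarith⟩
      rw [Metric.mem_ball, Real.dist_eq, add_sub_cancel_left, abs_of_pos (by positivity)]
      linarith
    exact ⟨fun _ _ => rfl, rfl, fun _ _ => rfl, fun _ _ => rfl, fun _ _ => ⟨rfl, rfl⟩, s, hs, t,
      ht, hst⟩
  case s11 δ =>
    subst h
    refine ⟨⟨t, ht, one_ne_zero⟩, ?_⟩
    simp
  case s12 =>
    subst h
    exact ⟨fun _ _ => rfl, one_ne_zero⟩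
  case s17 =>
    subst h
    exact ⟨fun _ _ => rfl, rfl, fun _ _ => rfl, fun _ _ => rfl, fun _ _ => ⟨rfl, rfl⟩,
      fun _ _ _ _ => rfl, t, ht, one_ne_zero⟩

/-- Closure under the bracket is automatic, because two multiples of the same field commute. -/
theorem isOneDimSubalgebra_span (hc : c.Smooth I) (h : vec I c ≠ 0) :
    IsOneDimSubalgebra I (Submodule.span ℝ {vec I c}) where
  le := by
    rw [Submodule.span_singleton_le_iff_mem]
    exact vec_mem_algebra hc
  bracket_mem V hV W hW := by
    obtain ⟨a, rfl⟩ := Submodule.mem_span_singleton.1 hV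
    obtain ⟨b, rfl⟩ := Submodule.mem_span_singleton.1 hW
    have : VectorField.lieBracket ℝ (a • vec I c) (b • vec I c) = 0 := by
      funext p
      simp only [VectorField.lieBracket, fderiv_const_smul_field, Pi.smul_apply, map_smul,
        smul_apply, Pi.zero_apply]
      rw [smul_comm, sub_self]
    rw [this]
    exact zero_mem _
  finrank_eq_one := finrank_span_singleton h

theorem IsOneDimSubalgebra.exists_coeffs (hI : IsOpenInterval I) {𝔰 : Submodule ℝ (Pt → Pt)}
    (h : IsOneDimSubalgebra I 𝔰) :
    ∃ c : Coeffs, c.Smooth I ∧ 𝔰 = Submodule.span ℝ {vec I c} := by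
  obtain ⟨v, -, hv⟩ := finrank_eq_one_iff'.1 h.finrank_eq_one
  obtain ⟨c, hc, hvc⟩ := exists_eq_vec hI.isOpen (h.le v.2)
  refine ⟨c, hc, le_antisymm (fun w hw => ?_) ?_⟩
  · obtain ⟨a, ha⟩ := hv ⟨w, hw⟩
    rw [Submodule.mem_span_singleton]
    exact ⟨a, by rw [← hvc]; exact congrArg Subtype.val ha⟩
  · rw [Submodule.span_singleton_le_iff_mem, ← hvc]
    exact v.2

/-! ### Reduction to normal form -/

/-- Some element of `G` maps the vector field over `I` with parameters `c` to that over `J` with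
parameters `d`. -/
def Rel (I : Set ℝ) (c : Coeffs) (J : Set ℝ) (d : Coeffs) : Prop :=
  ∃ Φ, PointSym I J Φ ∧ IsPushforward I Φ (vec I c) (vec J d)

theorem Rel.trans (h : Rel I c J d) (h' : Rel J d K e) : Rel I c K e := by
  obtain ⟨Φ, hΦ, hp⟩ := h
  obtain ⟨Ψ, hΨ, hp'⟩ := h'
  have h1 := hΦ.preservesTypes
  exact ⟨Ψ ∘ Φ, hΦ.comp hΨ, hp.comp h1.differentiableAt h1.mapsTo
    hΨ.preservesTypes.differentiableAt hp'⟩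

theorem Rel.swap (hI : IsOpenInterval I) (c : Coeffs) : Rel I c I c.swap :=
  ⟨swapL, .swap hI fun _ _ _ _ _ => rfl, isPushforward_swap hI.isOpen (fun _ _ => rfl) c⟩

theorem Rel.gEquivalent {a : ℝ} (ha : a ≠ 0) (h : Rel I c J (d.smul a)) :
    GEquivalent I (Submodule.span ℝ {vec I c}) J (Submodule.span ℝ {vec J d}) := by
  obtain ⟨Φ, hΦ, hp⟩ := h
  rw [vec_smul] at hp
  have key : ∀ b : ℝ, IsPushforward I Φ (b • vec I c) (b • a • vec J d) := fun b p hps => by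
    change b • (a • vec J d) (Φ p) = fderiv ℝ Φ p (b • vec I c p)
    rw [hp p hps, map_smul]
  refine ⟨Φ, hΦ, fun V hV => ?_, fun V hV => ?_⟩
  · obtain ⟨b, rfl⟩ := Submodule.mem_span_singleton.1 hV
    exact ⟨_, Submodule.smul_mem _ _ (Submodule.smul_mem _ _
      (Submodule.mem_span_singleton_self _)), key b⟩
  · obtain ⟨b, rfl⟩ := Submodule.mem_span_singleton.1 hV
    -- As `vec I c` goes to a times `vec J d`, the preimage of b times `vec J d` carries the factor
    -- b / a.
    refine ⟨_, Submodule.smul_mem _ (b / a) (Submodule.mem_span_singleton_self _), ?_⟩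
    have := key (b / a)
    rwa [smul_smul, div_mul_cancel₀ b ha] at this

theorem Rel.vec_ne_zero (h : Rel I c J d) (hd : vec J d ≠ 0) : vec I c ≠ 0 := fun h0 => hd <| by
  obtain ⟨Φ, hΦ, hp⟩ := h
  funext q
  by_cases hq : q ∈ slab J
  · obtain ⟨p, hpI, rfl⟩ := hΦ.preservesTypes.surjective q hq
    rw [hp p hpI, h0]
    simp
  · exact vec_apply_of_notMem hq

theorem Transf.Sends.rel {Θ : Transf} (hs : Θ.Sends I c d) (h : Θ.Smooth I)
    (hI : IsOpenInterval I) (hc : c.Smooth I) (hd : d.Smooth (Θ.T '' I)) :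
    Rel I c (Θ.T '' I) d :=
  ⟨Θ.map, .form Θ.T Θ.X₀ Θ.Y₀ Θ.W₀ Θ.W₁ Θ.W₂ Θ.C hI h.T h.X₀ h.Y₀ h.W₀ h.W₁ h.W₂ h.deriv_T rfl
    h.C fun _ _ _ _ _ => rfl, hs.isPushforward h hI hc hd fun _ _ => rfl⟩

/-- The effect of a change of the variable `t` that is not combined with shifts. -/
theorem exists_rel_reparametrization (hI : IsOpenInterval I) (hc : c.Smooth I) {T : ℝ → ℝ}
    (hT : SmoothOn I T) (hT' : ∀ t ∈ I, deriv T t ≠ 0) :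
    ∃ d : Coeffs, d.Smooth (T '' I) ∧ Rel I c (T '' I) d ∧ d.lam = c.lam ∧ ∀ t ∈ I,
      d.τ (T t) = deriv T t * c.τ t ∧ d.χ (T t) = cbrt (deriv T t) * c.χ t ∧
      d.ρ (T t) = cbrt (deriv T t) * c.ρ t ∧ d.α (T t) = c.α t / cbrt (deriv T t) ∧
      d.β (T t) = c.β t / cbrt (deriv T t) ∧ d.σ (T t) = c.σ t := by
  let Θ : Transf := ⟨T, fun _ => 0, fun _ => 0, fun _ => 0, fun _ => 0, fun _ => 0, 1⟩
  have h0 : SmoothOn I fun _ => 0 := .const 0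
  have hΘ : Θ.Smooth I := ⟨hT, h0, h0, h0, h0, h0, hT', one_ne_zero⟩
  obtain ⟨d, hd, hs⟩ := hΘ.exists_sends hI hc
  refine ⟨d, hd, hs.rel hΘ hI hc hd, hs.lam, fun t ht => ?_⟩
  have e := Θ.R_pow_three t
  refine ⟨(hs.τ t ht).trans ?_, (hs.χ t ht).trans ?_, (hs.ρ t ht).trans ?_, (hs.α t ht).trans ?_,
    (hs.β t ht).trans ?_, (hs.σ t ht).trans ?_⟩
  · rw [e]
  all_goals simp [Transf.newP, Transf.newR, Transf.newZ, Θ, Transf.R]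

/-- The effect of shifts if `τ` is constant. -/
theorem Rel.shift (hI : IsOpenInterval I) (hc : c.Smooth I) (hd : d.Smooth I)
    {X Y W₀ W₁ W₂ : ℝ → ℝ} {κ : ℝ} (hX : SmoothOn I X) (hY : SmoothOn I Y) (hW₀ : SmoothOn I W₀)
    (hW₁ : SmoothOn I W₁) (hW₂ : SmoothOn I W₂) (hτ : ∀ t ∈ I, c.τ t = κ)
    (hτ' : ∀ t ∈ I, d.τ t = κ) (hl : d.lam = c.lam)
    (hχ : ∀ t ∈ I, d.χ t = c.χ t + κ * deriv X t - c.lam * X t)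
    (hρ : ∀ t ∈ I, d.ρ t = c.ρ t + κ * deriv Y t - c.lam * Y t)
    (hα : ∀ t ∈ I, d.α t = c.α t - deriv X t * c.χ t + κ * deriv W₁ t - 2 * c.lam * W₁ t
      + deriv d.χ t * X t)
    (hβ : ∀ t ∈ I, d.β t = c.β t - deriv Y t * c.ρ t + κ * deriv W₂ t - 2 * c.lam * W₂ t
      + deriv d.ρ t * Y t)
    (hσ : ∀ t ∈ I, d.σ t = c.σ t + W₁ t * c.χ t + W₂ t * c.ρ t + κ * deriv W₀ t
      - 3 * c.lam * W₀ t + 1 / 2 * deriv d.χ t * X t ^ 2 + 1 / 2 * deriv d.ρ t * Y t ^ 2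
      - d.α t * X t - d.β t * Y t) :
    Rel I c I d := by
  let Θ : Transf := ⟨fun t => t, X, Y, W₀, W₁, W₂, 1⟩
  have hT : ∀ t, deriv Θ.T t = 1 := fun t => deriv_id t
  have hΘ : Θ.Smooth I := ⟨.id, hX, hY, hW₀, hW₁, hW₂, fun t _ => by simp [hT], one_ne_zero⟩
  have hC : Θ.C = 1 := rfl
  have hR : ∀ t, Θ.R t = 1 := fun t => by rw [Transf.R, hT, cbrt_one]
  -- With T = t and C = 1 the factor R is 1; as τ is constant, `rate` vanishes too, and the general
  -- formulas reduce to the stated ones.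
  have hR' : ∀ t, deriv Θ.R t = 0 := fun t => by
    rw [funext hR]; exact deriv_const t 1
  have ho := hI.isOpen
  have dτ : ∀ t ∈ I, deriv c.τ t = 0 := fun t ht =>
    (deriv_eq_of_eqOn ho hτ ht).trans (deriv_const t κ)
  have hr : ∀ t ∈ I, Θ.rate c.τ t = 0 := fun t ht => by simp [Transf.rate, dτ t ht, hR']
  have hr' : ∀ t ∈ I, deriv (Θ.rate c.τ) t = 0 := fun t ht =>
    (deriv_eq_of_eqOn ho hr ht).trans (deriv_const t 0)
  have p1 : ∀ t ∈ I, Θ.newP c.τ c.lam X c.χ t = d.χ t := fun t ht => by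
    rw [hχ t ht, Transf.newP, hr t ht, hR, hτ t ht, hC]; ring
  have p2 : ∀ t ∈ I, Θ.newP c.τ c.lam Y c.ρ t = d.ρ t := fun t ht => by
    rw [hρ t ht, Transf.newP, hr t ht, hR, hτ t ht, hC]; ring
  have r1 : ∀ t ∈ I, Θ.newR c.τ c.lam X W₁ c.χ c.α t = d.α t := fun t ht => by
    rw [hα t ht, Transf.newR, hr' t ht, hR, hτ t ht, dτ t ht, deriv_eq_of_eqOn ho p1 ht, hC]; ring
  have r2 : ∀ t ∈ I, Θ.newR c.τ c.lam Y W₂ c.ρ c.β t = d.β t := fun t ht => by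
    rw [hβ t ht, Transf.newR, hr' t ht, hR, hτ t ht, dτ t ht, deriv_eq_of_eqOn ho p2 ht, hC]; ring
  have himg : Θ.T '' I = I := image_id' I
  have hs : Θ.Sends I c d := ⟨fun t ht => (hτ' t ht).trans (by rw [hR, hτ t ht]; ring), hl,
    fun t ht => (p1 t ht).symm, fun t ht => (p2 t ht).symm, fun t ht => (r1 t ht).symm,
    fun t ht => (r2 t ht).symm, fun t ht => by
      have e1 : Θ.X₀ = X := rfl
      have e2 : Θ.Y₀ = Y := rfl
      have e3 : Θ.W₁ = W₁ := rfl
      have e4 : Θ.W₂ = W₂ := rfl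
      have e5 : Θ.W₀ = W₀ := rfl
      refine (hσ t ht).trans ?_
      rw [Transf.newZ, e1, e2, e3, e4, e5, r1 t ht, r2 t ht, hr' t ht, hR, hτ t ht,
        deriv_eq_of_eqOn ho p1 ht, deriv_eq_of_eqOn ho p2 ht, hC]
      ring⟩
  have := hs.rel hΘ hI hc (by rwa [himg])
  rwa [himg] at this

/-- If `τ` is constant and `τ` or `λ` is nonzero, then all other parameters can be removed. -/
theorem Rel.remove_all (hI : IsOpenInterval I) (hc : c.Smooth I) {κ : ℝ}
    (hτ : ∀ t ∈ I, c.τ t = κ) (h : κ ≠ 0 ∨ c.lam ≠ 0) :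
    Rel I c I { Coeffs.zero with τ := fun _ => κ, lam := c.lam } := by
  have ho := hI.isOpen
  -- The order matters: X and Y remove χ and ρ, their derivatives enter the equations for W₁ and W₂,
  -- and these enter that for W₀. The weights λ, 2λ, 3λ are harmless, since κ and λ are not both
  -- zero.
  obtain ⟨X, hX, hX'⟩ := exists_linear_ode_solution hI hc.χ.neg h
  obtain ⟨Y, hY, hY'⟩ := exists_linear_ode_solution hI hc.ρ.neg h
  obtain ⟨W₁, hW₁, hW₁'⟩ := exists_linear_ode_solution (κ := κ) (μ := 2 * c.lam) hI
    (((hX.deriv ho).mul hc.χ).sub hc.α) (by simpa using h)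
  obtain ⟨W₂, hW₂, hW₂'⟩ := exists_linear_ode_solution (κ := κ) (μ := 2 * c.lam) hI
    (((hY.deriv ho).mul hc.ρ).sub hc.β) (by simpa using h)
  obtain ⟨W₀, hW₀, hW₀'⟩ := exists_linear_ode_solution (κ := κ) (μ := 3 * c.lam) hI
    ((hc.σ.add (hW₁.mul hc.χ)).add (hW₂.mul hc.ρ)).neg (by simpa using h)
  have h0 : SmoothOn I fun _ => 0 := .const 0
  refine Rel.shift hI hc ⟨.const κ, h0, h0, h0, h0, h0⟩ hX hY hW₀ hW₁ hW₂ hτ (fun _ _ => rfl) rfl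
    (fun t ht => ?_) (fun t ht => ?_) (fun t ht => ?_) (fun t ht => ?_) (fun t ht => ?_) <;>
    simp only [Coeffs.zero, deriv_const]
  · linear_combination -(hX' t ht)
  · linear_combination -(hY' t ht)
  · linear_combination -(hW₁' t ht)
  · linear_combination -(hW₂' t ht)
  · linear_combination -(hW₀' t ht)

/-- Over some subinterval, the vector field with parameters `c` is equivalent to a multiple of one
in normal form. -/
def Normalizable (I : Set ℝ) (c : Coeffs) : Prop :=
  ∃ J ⊆ I, IsOpenInterval J ∧ ∃ (k : Family) (J' : Set ℝ) (d : Coeffs) (a : ℝ),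
    a ≠ 0 ∧ Normal J' k d ∧ Rel J c J' (d.smul a)

theorem Rel.congr (hJ : IsOpen J) (h : Rel I c J d) (hτ : ∀ t ∈ J, d.τ t = e.τ t)
    (hl : d.lam = e.lam) (hχ : ∀ t ∈ J, d.χ t = e.χ t) (hρ : ∀ t ∈ J, d.ρ t = e.ρ t)
    (hα : ∀ t ∈ J, d.α t = e.α t) (hβ : ∀ t ∈ J, d.β t = e.β t) (hσ : ∀ t ∈ J, d.σ t = e.σ t) :
    Rel I c J e := by
  rwa [Rel, ← vec_congr hJ hτ hl hχ hρ hα hβ hσ]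

theorem Normalizable.of_rel (hJ : J ⊆ I) (hJ' : IsOpenInterval J) (hd : Normal K k d)
    (h : Rel J c K d) : Normalizable I c := by
  have : d.smul 1 = d := by simp [Coeffs.smul]
  exact ⟨J, hJ, hJ', k, K, d, 1, one_ne_zero, hd, by rwa [this]⟩

theorem Normalizable.of_tau (hI : IsOpenInterval I) (hc : c.Smooth I) (h : ∃ t ∈ I, c.τ t ≠ 0) :
    Normalizable I c := by
  obtain ⟨t, ht, h0⟩ := h
  obtain ⟨J, hJI, hJ, -, hJ0⟩ := exists_isOpenInterval_forall hI ht
    ((hc.τ.continuousAt hI.isOpen ht).eventually_ne h0)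
  -- Here λ cannot be changed, so τ is brought to λ rather than to 1 when λ ≠ 0; the field is then λ
  -- times the generator with δ = 1.
  obtain ⟨κ, δ, hκ, hδ⟩ : ∃ (κ : ℝ) (δ : Fin 2), κ ≠ 0 ∧ c.lam = κ * ((δ : ℕ) : ℝ) := by
    by_cases hl : c.lam = 0
    · exact ⟨1, 0, one_ne_zero, by simp [hl]⟩
    · exact ⟨c.lam, 1, hl, by simp⟩
  have hcJ := hc.mono hJI
  obtain ⟨T, hT, hT'⟩ := exists_antiderivative hJ ((SmoothOn.const κ).div hcJ.τ hJ0)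
  have hT0 : ∀ t ∈ J, deriv T t ≠ 0 := fun t ht => by
    rw [hT' t ht]; exact div_ne_zero hκ (hJ0 t ht)
  obtain ⟨d, hd, hrel, hl, hval⟩ := exists_rel_reparametrization hJ hcJ hT hT0
  have hτ : ∀ s ∈ T '' J, d.τ s = κ := by
    rintro _ ⟨t, ht, rfl⟩
    rw [(hval t ht).1, hT' t ht, div_mul_cancel₀ _ (hJ0 t ht)]
  refine ⟨J, hJI, hJ, .s11 δ, T '' J, _, κ, hκ, rfl, ?_⟩
  have := hrel.trans (Rel.remove_all (hJ.image hT hT0) hd hτ (.inl hκ))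
  simpa [Coeffs.smul, Coeffs.zero, hl, hδ] using this

theorem Normalizable.of_lam (hI : IsOpenInterval I) (hc : c.Smooth I) (hτ : ∀ t ∈ I, c.τ t = 0)
    (hl : c.lam ≠ 0) : Normalizable I c := by
  refine ⟨I, subset_rfl, hI, .s12, I, _, c.lam, hl, rfl, ?_⟩
  simpa [Coeffs.smul, Coeffs.zero] using Rel.remove_all hI hc hτ (.inr hl)

/-- If `τ = λ = 0` and `χ` vanishes nowhere, it can be made equal to `1`. -/
theorem exists_rel_chi_eq_one (hI : IsOpenInterval I) (hc : c.Smooth I) (hτ : ∀ t ∈ I, c.τ t = 0)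
    (hχ : ∀ t ∈ I, c.χ t ≠ 0) : ∃ (J : Set ℝ) (d : Coeffs), IsOpenInterval J ∧ d.Smooth J ∧
      Rel I c J d ∧ d.lam = c.lam ∧ (∀ t ∈ J, d.τ t = 0) ∧ (∀ t ∈ J, d.χ t = 1) ∧
      ((∀ t ∈ I, c.ρ t ≠ 0) → ∀ t ∈ J, d.ρ t ≠ 0) ∧ ((∀ t ∈ I, c.ρ t = 0) → ∀ t ∈ J, d.ρ t = 0) := by
  -- The new χ is T_t^{1/3} χ, which is 1 for T_t = χ⁻³.
  obtain ⟨T, hT, hT'⟩ := exists_antiderivative hI (((SmoothOn.const 1).div hc.χ hχ).pow 3)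
  have hT0 : ∀ t ∈ I, deriv T t ≠ 0 := fun t ht => by
    rw [hT' t ht]; exact pow_ne_zero 3 (div_ne_zero one_ne_zero (hχ t ht))
  obtain ⟨d, hd, hrel, hl, hval⟩ := exists_rel_reparametrization hI hc hT hT0
  have hcb : ∀ t ∈ I, cbrt (deriv T t) = 1 / c.χ t := fun t ht => by rw [hT' t ht, cbrt_cube]
  refine ⟨T '' I, d, hI.image hT hT0, hd, hrel, hl, ?_, ?_, fun h => ?_, fun h => ?_⟩ <;>
    rintro _ ⟨t, ht, rfl⟩
  · rw [(hval t ht).1, hτ t ht, mul_zero]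
  · rw [(hval t ht).2.1, hcb t ht, one_div_mul_cancel (hχ t ht)]
  · rw [(hval t ht).2.2.1, hcb t ht]
    exact mul_ne_zero (one_div_ne_zero (hχ t ht)) (h t ht)
  · rw [(hval t ht).2.2.1, h t ht, mul_zero]

theorem Normalizable.of_chi_of_rho (hI : IsOpenInterval I) (hc : c.Smooth I)
    (hτ : ∀ t ∈ I, c.τ t = 0) (hl : c.lam = 0) (h : ∃ t ∈ I, c.χ t ≠ 0 ∧ c.ρ t ≠ 0) :
    Normalizable I c := by
  obtain ⟨t, ht, h1, h2⟩ := h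
  obtain ⟨J, hJI, hJ, -, hJ0⟩ := exists_isOpenInterval_forall hI ht
    (((hc.χ.continuousAt hI.isOpen ht).eventually_ne h1).and
      ((hc.ρ.continuousAt hI.isOpen ht).eventually_ne h2))
  obtain ⟨K, d, hK, hd, hrel, hdl, hdτ, hdχ, hdρ, -⟩ := exists_rel_chi_eq_one hJ (hc.mono hJI)
    (fun t ht => hτ t (hJI ht)) fun t ht => (hJ0 t ht).1
  replace hdρ := hdρ fun t ht => (hJ0 t ht).2
  have ho := hK.isOpen
  rw [hl] at hdl
  -- With τ = λ = 0 and χ = 1 the new α is α - X_t. The new β is β - Y_t ρ + ρ_t Y, and Y = ρ F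
  -- turns this into β - ρ² F_t.
  obtain ⟨X, hX, hX'⟩ := exists_antiderivative hK hd.α
  obtain ⟨F, hF, hF'⟩ := exists_antiderivative hK (hd.β.div (hd.ρ.pow 2) fun t ht =>
    pow_ne_zero 2 (hdρ t ht))
  have h0 : SmoothOn K fun _ => 0 := .const 0
  have hY : SmoothOn K fun t => d.ρ t * F t := hd.ρ.mul hF
  obtain ⟨s, hs⟩ := hK.nonempty
  refine .of_rel (k := .s13) hJI hJ ⟨d.ρ, hd.ρ, ⟨s, hs, hdρ s hs⟩, rfl⟩ (hrel.trans ?_)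
  -- As τ = λ = 0, W₁ does not affect α and enters σ with coefficient χ = 1, so it can absorb all
  -- that is left of σ.
  refine Rel.shift hK hd ⟨h0, .const 1, hd.ρ, h0, h0, h0⟩ hX hY h0
    (W₁ := fun t => -(d.σ t + 1 / 2 * deriv d.ρ t * (d.ρ t * F t) ^ 2))
    (hd.σ.add (((SmoothOn.const _).mul (hd.ρ.deriv ho)).mul (hY.pow 2))).neg h0 hdτ
    (fun _ _ => rfl) hdl.symm (fun t ht => ?_) (fun t ht => ?_) (fun t ht => ?_) (fun t ht => ?_)
    (fun t ht => ?_) <;> simp only [Coeffs.zero, deriv_const, hdl, hdχ t ht]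
  · ring
  · ring
  · rw [hX' t ht]; ring
  · have h3 : deriv (fun t => d.ρ t * F t) t = _ :=
      ((hd.ρ.hasDerivAt ho ht).mul (hF.hasDerivAt ho ht)).deriv
    rw [h3, hF' t ht]
    have := hdρ t ht
    field_simp
    ring
  · ring

/-- With ρ = 0 no shift affects β, which is why it survives as a parameter of the family; X removes
α and W₁ = -σ removes σ. -/
theorem Normalizable.of_chi (hI : IsOpenInterval I) (hc : c.Smooth I)
    (hτ : ∀ t ∈ I, c.τ t = 0) (hl : c.lam = 0) (hχ : ∀ t ∈ I, c.χ t ≠ 0)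
    (hρ : ∀ t ∈ I, c.ρ t = 0) : Normalizable I c := by
  obtain ⟨K, d, hK, hd, hrel, hdl, hdτ, hdχ, -, hdρ⟩ := exists_rel_chi_eq_one hI hc hτ hχ
  replace hdρ := hdρ hρ
  rw [hl] at hdl
  obtain ⟨X, hX, hX'⟩ := exists_antiderivative hK hd.α
  have h0 : SmoothOn K fun _ => 0 := .const 0
  refine .of_rel (k := .s14) subset_rfl hI ⟨d.β, hd.β, rfl⟩ (hrel.trans ?_)
  refine Rel.shift hK hd ⟨h0, .const 1, h0, h0, hd.β, h0⟩ hX h0 h0 hd.σ.neg h0 hdτ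
    (fun _ _ => rfl) hdl.symm (fun t ht => ?_) (fun t ht => ?_) (fun t ht => ?_) (fun t ht => ?_)
    (fun t ht => ?_) <;> simp only [Coeffs.zero, deriv_const, hdl, hdχ t ht, hdρ t ht]
  · ring
  · ring
  · rw [hX' t ht]; ring
  · ring
  · ring

theorem Normalizable.of_alpha (hI : IsOpenInterval I) (hc : c.Smooth I)
    (hτ : ∀ t ∈ I, c.τ t = 0) (hl : c.lam = 0) (hχ : ∀ t ∈ I, c.χ t = 0)
    (hρ : ∀ t ∈ I, c.ρ t = 0) (hα : ∀ t ∈ I, c.α t ≠ 0) : Normalizable I c := by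
  obtain ⟨T, hT, hT'⟩ := exists_antiderivative hI (hc.α.pow 3)
  have hT0 : ∀ t ∈ I, deriv T t ≠ 0 := fun t ht => by
    rw [hT' t ht]; exact pow_ne_zero 3 (hα t ht)
  obtain ⟨d, hd, hrel, hdl, hval⟩ := exists_rel_reparametrization hI hc hT hT0
  have hK := hI.image hT hT0
  have h0 : SmoothOn (T '' I) fun _ => 0 := .const 0
  rw [hl] at hdl
  have hdτ : ∀ s ∈ T '' I, d.τ s = 0 := by
    rintro _ ⟨t, ht, rfl⟩
    rw [(hval t ht).1, hτ t ht, mul_zero]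
  have hdχ : ∀ s ∈ T '' I, d.χ s = 0 := by
    rintro _ ⟨t, ht, rfl⟩
    rw [(hval t ht).2.1, hχ t ht, mul_zero]
  have hdρ : ∀ s ∈ T '' I, d.ρ s = 0 := by
    rintro _ ⟨t, ht, rfl⟩
    rw [(hval t ht).2.2.1, hρ t ht, mul_zero]
  have hdα : ∀ s ∈ T '' I, d.α s = 1 := by
    rintro _ ⟨t, ht, rfl⟩
    rw [(hval t ht).2.2.2.1, hT' t ht, cbrt_cube, div_self (hα t ht)]
  refine .of_rel (k := .s15) subset_rfl hI ⟨d.β, hd.β, rfl⟩ (hrel.trans ?_)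
  -- With χ = ρ = 0 and α = 1 the new σ is σ - X - β Y, so X = σ and Y = 0 remove it.
  refine Rel.shift hK hd ⟨h0, h0, h0, .const 1, hd.β, h0⟩ hd.σ h0 h0 h0 h0 hdτ
    (fun _ _ => rfl) hdl.symm (fun t ht => ?_) (fun t ht => ?_) (fun t ht => ?_) (fun t ht => ?_)
    (fun t ht => ?_) <;> simp only [Coeffs.zero, deriv_const, hdl, hdχ t ht, hdρ t ht, hdα t ht] <;>
    ring

theorem Normalizable.of_sigma (hI : IsOpenInterval I) (hc : c.Smooth I)
    (hτ : ∀ t ∈ I, c.τ t = 0) (hl : c.lam = 0) (hχ : ∀ t ∈ I, c.χ t = 0)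
    (hρ : ∀ t ∈ I, c.ρ t = 0) (hα : ∀ t ∈ I, c.α t = 0) (hβ : ∀ t ∈ I, c.β t = 0)
    (hσ : ∀ t ∈ I, deriv c.σ t ≠ 0) : Normalizable I c := by
  -- The function σ itself serves as the new variable t.
  obtain ⟨d, hd, hrel, hdl, hval⟩ := exists_rel_reparametrization hI hc hc.σ hσ
  refine .of_rel (k := .s16) subset_rfl hI rfl (hrel.congr (hI.image hc.σ hσ).isOpen ?_
    (hdl.trans hl) ?_ ?_ ?_ ?_ ?_) <;> rintro _ ⟨t, ht, rfl⟩ <;>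
    obtain ⟨h1, h2, h3, h4, h5, h6⟩ := hval t ht
  · rw [h1, hτ t ht, mul_zero]; rfl
  · rw [h2, hχ t ht, mul_zero]; rfl
  · rw [h3, hρ t ht, mul_zero]; rfl
  · rw [h4, hα t ht, zero_div]; rfl
  · rw [h5, hβ t ht, zero_div]; rfl
  · exact h6

theorem Normalizable.of_sigma_const (hI : IsOpenInterval I)
    (hτ : ∀ t ∈ I, c.τ t = 0) (hl : c.lam = 0) (hχ : ∀ t ∈ I, c.χ t = 0)
    (hρ : ∀ t ∈ I, c.ρ t = 0) (hα : ∀ t ∈ I, c.α t = 0) (hβ : ∀ t ∈ I, c.β t = 0) {a : ℝ}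
    (ha : a ≠ 0) (hσ : ∀ t ∈ I, c.σ t = a) : Normalizable I c := by
  refine ⟨I, subset_rfl, hI, .s17, I, _, a, ha, rfl, ?_⟩
  have hz : ∀ {f : ℝ → ℝ}, (∀ t ∈ I, f t = 0) → ∀ t ∈ I, f t = a * 0 := fun h t ht => by
    rw [h t ht, mul_zero]
  -- The field is already a multiple of the normal one; the permutation serves as an element of G
  -- that fixes it.
  exact (Rel.swap hI c).congr hI.isOpen (hz hτ) (by simp [Coeffs.swap, Coeffs.smul, hl, Coeffs.zero])
    (hz hρ) (hz hχ) (hz hβ) (hz hα) fun t ht => (hσ t ht).trans (mul_one a).symm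

theorem Normalizable.mono (hJ : J ⊆ I) (h : Normalizable J c) : Normalizable I c := by
  obtain ⟨K, hK, h⟩ := h
  exact ⟨K, hK.trans hJ, h⟩

theorem Normalizable.of_swap (h : Normalizable I c.swap) : Normalizable I c := by
  obtain ⟨J, hJI, hJ, k, J', d, a, ha, hd, hrel⟩ := h
  exact ⟨J, hJI, hJ, k, J', d, a, ha, hd, (Rel.swap hJ c).trans hrel⟩

theorem Coeffs.Smooth.swap (hc : c.Smooth I) : c.swap.Smooth I :=
  ⟨hc.τ, hc.ρ, hc.χ, hc.β, hc.α, hc.σ⟩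

/-- The leading parameter that is nonzero at some point selects the case, and continuity keeps it
nonzero on a smaller interval. The cases led by ρ or β reduce to those led by χ or α through the
permutation. -/
theorem normalizable_of_vec_ne_zero (hI : IsOpenInterval I) (hc : c.Smooth I)
    (h : vec I c ≠ 0) : Normalizable I c := by
  have ho := hI.isOpen
  by_cases hτ : ∃ t ∈ I, c.τ t ≠ 0
  · exact .of_tau hI hc hτ
  push Not at hτ
  by_cases hl : c.lam = 0
  swap
  · exact .of_lam hI hc hτ hl
  -- Over the whole interval χ and ρ may both be nonzero functions with product zero. Asking for a
  -- common point settles this: if there is none, ρ vanishes wherever χ does not.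
  by_cases hχρ : ∃ t ∈ I, c.χ t ≠ 0 ∧ c.ρ t ≠ 0
  · exact .of_chi_of_rho hI hc hτ hl hχρ
  push Not at hχρ
  by_cases hχ : ∃ t ∈ I, c.χ t ≠ 0
  · obtain ⟨t, ht, hχ⟩ := hχ
    obtain ⟨J, hJI, hJ, -, hJ0⟩ := exists_isOpenInterval_forall hI ht
      ((hc.χ.continuousAt ho ht).eventually_ne hχ)
    exact .mono hJI (.of_chi hJ (hc.mono hJI) (fun t ht => hτ t (hJI ht)) hl hJ0
      fun t ht => hχρ t (hJI ht) (hJ0 t ht))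
  push Not at hχ
  by_cases hρ : ∃ t ∈ I, c.ρ t ≠ 0
  · obtain ⟨t, ht, hρ⟩ := hρ
    obtain ⟨J, hJI, hJ, -, hJ0⟩ := exists_isOpenInterval_forall hI ht
      ((hc.ρ.continuousAt ho ht).eventually_ne hρ)
    exact .mono hJI (.of_swap (.of_chi hJ (hc.mono hJI).swap (fun t ht => hτ t (hJI ht)) hl hJ0
      fun t ht => hχ t (hJI ht)))
  push Not at hρ
  by_cases hα : ∃ t ∈ I, c.α t ≠ 0
  · obtain ⟨t, ht, hα⟩ := hα
    obtain ⟨J, hJI, hJ, -, hJ0⟩ := exists_isOpenInterval_forall hI ht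
      ((hc.α.continuousAt ho ht).eventually_ne hα)
    exact .mono hJI (.of_alpha hJ (hc.mono hJI) (fun t ht => hτ t (hJI ht)) hl
      (fun t ht => hχ t (hJI ht)) (fun t ht => hρ t (hJI ht)) hJ0)
  push Not at hα
  by_cases hβ : ∃ t ∈ I, c.β t ≠ 0
  · obtain ⟨t, ht, hβ⟩ := hβ
    obtain ⟨J, hJI, hJ, -, hJ0⟩ := exists_isOpenInterval_forall hI ht
      ((hc.β.continuousAt ho ht).eventually_ne hβ)
    exact .mono hJI (.of_swap (.of_alpha hJ (hc.mono hJI).swap (fun t ht => hτ t (hJI ht)) hl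
      (fun t ht => hρ t (hJI ht)) (fun t ht => hχ t (hJI ht)) hJ0))
  push Not at hβ
  by_cases hσ : ∃ t ∈ I, deriv c.σ t ≠ 0
  · obtain ⟨t, ht, hσ⟩ := hσ
    obtain ⟨J, hJI, hJ, -, hJ0⟩ := exists_isOpenInterval_forall hI ht
      (((hc.σ.deriv ho).continuousAt ho ht).eventually_ne hσ)
    exact .mono hJI (.of_sigma hJ (hc.mono hJI) (fun t ht => hτ t (hJI ht)) hl
      (fun t ht => hχ t (hJI ht)) (fun t ht => hρ t (hJI ht)) (fun t ht => hα t (hJI ht))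
      (fun t ht => hβ t (hJI ht)) hJ0)
  push Not at hσ
  obtain ⟨s, hs⟩ := hI.nonempty
  have hconst : ∀ t ∈ I, c.σ t = c.σ s := fun t ht =>
    hI.isOpen.is_const_of_deriv_eq_zero hI.ordConnected.isPreconnected
      (fun t ht => (hc.σ.differentiableAt ho ht).differentiableWithinAt) hσ ht hs
  refine .of_sigma_const hI hτ hl hχ hρ hα hβ (a := c.σ s) (fun h0 => h ?_) hconst
  exact (vec_congr ho hτ hl hχ hρ hα hβ fun t ht => (hconst t ht).trans h0).trans (vec_zero I)

/-! ### Assembly of the classification -/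

theorem map_restrict_span (h : J ⊆ I) (c : Coeffs) :
    (Submodule.span ℝ {vec I c}).map (restrict J) = Submodule.span ℝ {vec J c} := by
  rw [Submodule.map_span, image_singleton, restrict_vec h]

theorem Family.Mem.isOneDimSubalgebra {𝔰 : Submodule ℝ (Pt → Pt)} (hI : IsOpenInterval I)
    (hk : k.Mem I 𝔰) : IsOneDimSubalgebra I 𝔰 := by
  obtain ⟨c, hc, rfl⟩ := mem_iff_normal.1 hk
  exact isOneDimSubalgebra_span hc.smooth ((hc.hasType hI).vec_ne_zero hI)

theorem IsOneDimSubalgebra.exists_existsUnique_family {𝔰 : Submodule ℝ (Pt → Pt)} {I₀ : Set ℝ}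
    (hI : IsOpenInterval I) (h𝔰 : IsOneDimSubalgebra I 𝔰) (hI₀ : I₀ ⊆ I)
    (hI₀' : IsOpenInterval I₀) (hne : 𝔰.map (restrict I₀) ≠ ⊥) :
    ∃ J ⊆ I₀, IsOpenInterval J ∧ IsOneDimSubalgebra J (𝔰.map (restrict J)) ∧
      ∃! k : Family, ∃ (J' : Set ℝ) (𝔰' : Submodule ℝ (Pt → Pt)), IsOpenInterval J' ∧
        k.Mem J' 𝔰' ∧ GEquivalent J (𝔰.map (restrict J)) J' 𝔰' := by
  obtain ⟨c, hc, rfl⟩ := h𝔰.exists_coeffs hI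
  rw [map_restrict_span hI₀, Ne, Submodule.span_singleton_eq_bot] at hne
  obtain ⟨J, hJ, hJ', k, K, d, a, ha, hd, hrel⟩ :=
    normalizable_of_vec_ne_zero hI₀' (hc.mono hI₀) hne
  have hcJ := hc.mono (hJ.trans hI₀)
  have hK : IsOpenInterval K := by
    obtain ⟨Φ, hΦ, -⟩ := hrel
    exact hΦ.preservesTypes.target
  have hvd := (hd.hasType hK).vec_ne_zero hK
  have hv : vec J c ≠ 0 := hrel.vec_ne_zero (by
    rw [vec_smul]
    exact smul_ne_zero ha hvd)
  -- Uniqueness refers to the type over the shrunken interval J, which may differ from the type over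
  -- I₀.
  obtain ⟨k₀, hk₀⟩ := HasType.exists_of_ne_zero hJ' hv
  have huniq : ∀ k, (∃ (J' : Set ℝ) (𝔰' : Submodule ℝ (Pt → Pt)), IsOpenInterval J' ∧
      k.Mem J' 𝔰' ∧ GEquivalent J (Submodule.span ℝ {vec J c}) J' 𝔰') → k = k₀ := by
    rintro k ⟨J', 𝔰', hJ', hk, h⟩
    obtain ⟨e, he, rfl⟩ := mem_iff_normal.1 hk
    exact (he.hasType hJ').unique (h.hasType hcJ hk₀)
  refine ⟨J, hJ, hJ', ?_⟩
  rw [map_restrict_span (hJ.trans hI₀)]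
  have hex : ∃ (J' : Set ℝ) (𝔰' : Submodule ℝ (Pt → Pt)), IsOpenInterval J' ∧
      k.Mem J' 𝔰' ∧ GEquivalent J (Submodule.span ℝ {vec J c}) J' 𝔰' :=
    ⟨K, _, hK, mem_iff_normal.2 ⟨d, hd, rfl⟩, hrel.gEquivalent ha⟩
  exact ⟨isOneDimSubalgebra_span hcJ hv, k, hex, fun k' hk' =>
    (huniq k' hk').trans (huniq k hex).symm⟩

theorem Family.Mem.eq_of_gEquivalent {𝔰 𝔰' : Submodule ℝ (Pt → Pt)} {k' : Family}
    (hI : IsOpenInterval I) (hJ : IsOpenInterval J) (hk : k.Mem I 𝔰) (hk' : k'.Mem J 𝔰')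
    (h : GEquivalent I 𝔰 J 𝔰') : k = k' := by
  obtain ⟨c, hc, rfl⟩ := mem_iff_normal.1 hk
  obtain ⟨d, hd, rfl⟩ := mem_iff_normal.1 hk'
  exact (h.hasType hc.smooth (hc.hasType hI)).unique (hd.hasType hJ)

end

end

end Nizhnik

theorem mainTheorem1 :
    -- the listed families consist of one-dimensional subalgebras
    (∀ (k : Nizhnik.Family) (I : Set ℝ) (𝔰 : Submodule ℝ (Nizhnik.Pt → Nizhnik.Pt)),
      Nizhnik.IsOpenInterval I → k.Mem I 𝔰 → Nizhnik.IsOneDimSubalgebra I 𝔰) ∧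
    -- every one-dimensional subalgebra is locally equivalent to a member of exactly one family
    (∀ (I : Set ℝ) (𝔰 : Submodule ℝ (Nizhnik.Pt → Nizhnik.Pt)),
      Nizhnik.IsOpenInterval I → Nizhnik.IsOneDimSubalgebra I 𝔰 →
      ∀ I₀ ⊆ I, Nizhnik.IsOpenInterval I₀ → 𝔰.map (Nizhnik.restrict I₀) ≠ ⊥ →
      ∃ J ⊆ I₀, Nizhnik.IsOpenInterval J ∧
        Nizhnik.IsOneDimSubalgebra J (𝔰.map (Nizhnik.restrict J)) ∧
        ∃! k : Nizhnik.Family, ∃ (J' : Set ℝ) (𝔰' : Submodule ℝ (Nizhnik.Pt → Nizhnik.Pt)),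
          Nizhnik.IsOpenInterval J' ∧ k.Mem J' 𝔰' ∧
          Nizhnik.GEquivalent J (𝔰.map (Nizhnik.restrict J)) J' 𝔰') ∧
    -- members of different families are inequivalent
    (∀ (k k' : Nizhnik.Family) (I J : Set ℝ) (𝔰 𝔰' : Submodule ℝ (Nizhnik.Pt → Nizhnik.Pt)),
      Nizhnik.IsOpenInterval I → Nizhnik.IsOpenInterval J → k.Mem I 𝔰 → k'.Mem J 𝔰' →
      Nizhnik.GEquivalent I 𝔰 J 𝔰' → k = k') := by
  exact ⟨fun _ _ _ hI hk => hk.isOneDimSubalgebra hI,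
    fun _ _ hI h𝔰 _ hI₀ hI₀' hne => h𝔰.exists_existsUnique_family hI hI₀ hI₀' hne,
    fun _ _ _ _ _ _ hI hJ hk hk' h => hk.eq_of_gEquivalent hI hJ hk' h⟩
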